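/- Let $\Sigma$ be a finite non-empty alphabet. A substitution is a non-erasing morphism $\sigma\colon\Sigma^*\to\Sigma^*$; $S(\Sigma)$ is the set of all substitutions. A sequence $s=(\sigma_n)_{n\in\mathbb N}\in S(\Sigma)^\omega$ directs $\alpha\in\Sigma^\omega$ if there are infinite words $\alpha^{(0)}=\alpha,\alpha^{(1)},\alpha^{(2)},\dots$ with $\alpha^{(n)}=\sigma_n(\alpha^{(n+1)})$ for all $n$. A language $L\subseteq\Sigma^\omega$ is $\omega$-regular if it is accepted by a nondeterministic Büchi automaton with finitely many states; equivalently, if there are a finite $\omega$-semigroup $M_L=(M_f,M_\omega)$, a morphism $h_L\colon\Sigma^\infty\to M_L$ (with $\Sigma^\infty=\Sigma^+\cup\Sigma^\omega$) and a set $H\subseteq M_\omega$ with $L=\{\alpha\in\Sigma^\omega: h_L(\alpha)\in H\}$. Finite $\omega$-semigroups are represented by the tables of the product, the mixed product, and the map $x\mapsto x^\omega$. Given such $M_L$, every map $h\colon\Sigma\to M_f$ is extended to a morphism from $\Sigma^*$ to $M_f$ with a fresh neutral element adjoined. For $\sigma\in S(\Sigma)$, $a\in\Sigma$ and $h\colon\Sigma\to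 M_f$ write $\sigma(a)=b_1v_1\cdots b_dv_d$ with distinct letters $b_1,\dots,b_d$ and $v_i\in\{b_1,\dots,b_i\}^*$, and put $\mathsf{segments}_\sigma(a,h)=\langle(b_1,h(v_1)),\dots,(b_d,h(v_d))\rangle$. Let $\sigma\equiv_L\mu$ iff $\mathsf{segments}_\sigma=\mathsf{segments}_\mu$, let $[\sigma]_L$ be the class of $\sigma$, $\Xi_L$ the set of all classes, and $\mathsf{trace}_L((\sigma_n)_n)=([\sigma_n]_L)_n\in\Xi_L^\omega$. Theorem. 1. From a Büchi automaton accepting $L$ one can compute a finite $\omega$-semigroup $M_L$, a morphism $h_L$ and a set $H$ that recognise $L$. For every finite $\omega$-semigroup $M_L$ with a morphism $h_L$ and a set $H$ recognising $L$, the set $\Xi_L$ is a finite monoid under $[\sigma]_L\cdot[\mu]_L=[\sigma\circ\mu]_L$ with identity $[\mathrm{id}]_L$, and one can compute from $(M_L,h_L,H)$ a Büchi automaton $\mathcal B$ over the alphabet $\Xi_L$ (whose letters are given by representing substitutions) such that for all $s\in S(\Sigma)^\omega$, $\mathcal B$ accepts $\mathsf{trace}_L(s)$ if and only if $s$ directs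 some $\alpha\in L$. 2. From a Büchi automaton accepting $L$ and a finite set $S\subseteq S(\Sigma)$ one can compute a Büchi automaton $\mathcal B$ over the alphabet $S$ such that for all $s\in S^\omega$, $\mathcal B$ accepts $s$ if and only if $s$ directs some $\alpha\in L$. -/

import Mathlib

universe u v w

/-! ### Finite and infinite words, substitutions, directive sequences -/

/-- The finite prefix `α(0) ⋯ α(n-1)` of an infinite word `α`. -/
def wordPrefix {A : Type u} (α : ℕ → A) (n : ℕ) : List A :=
  (List.range n).map α

/-- A non-erasing morphism of the free monoid `A*`, given by the non-empty images of the letters. -/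
@[ext]
structure Substitution (A : Type u) where
  img : A → List A
  img_ne_nil : ∀ a, img a ≠ []

namespace Substitution

variable {A : Type u}

/-- The image of a finite word under a substitution. -/
def onWord (σ : Substitution A) (x : List A) : List A :=
  x.flatMap σ.img

/-- `σ.MapsTo α β` says that `β = σ(α)` for the infinite words `α`, `β`: the image of every finite
prefix of `α` is a prefix of `β`. As `σ` is non-erasing, this determines `β`. -/
def MapsTo (σ : Substitution A) (α β : ℕ → A) : Prop :=
  ∀ n, σ.onWord (wordPrefix α n) = wordPrefix β (σ.onWord (wordPrefix α n)).length

/-- The identity substitution. -/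
def id (A : Type u) : Substitution A where
  img a := [a]
  img_ne_nil _ := by simp

/-- The composition `σ ∘ μ`. -/
def comp (σ μ : Substitution A) : Substitution A where
  img a := σ.onWord (μ.img a)
  img_ne_nil a := by
    obtain ⟨b, x, hb⟩ := List.exists_cons_of_ne_nil (μ.img_ne_nil a)
    simp [onWord, hb, σ.img_ne_nil b]

end Substitution

/-- The sequence `s` of substitutions directs the infinite word `α`. -/
def Directs {A : Type u} (s : ℕ → Substitution A) (α : ℕ → A) : Prop :=
  ∃ β : ℕ → (ℕ → A), β 0 = α ∧ ∀ n, (s n).MapsTo (β (n + 1)) (β n)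

/-! ### Büchi automata -/

/-- A (nondeterministic) Büchi automaton over the alphabet `A` with state set `Q`. -/
structure Buchi (A : Type u) (Q : Type v) where
  start : Set Q
  trans : Set (Q × A × Q)
  accept : Set Q

/-- The automaton has a run on `α` that visits accepting states infinitely often. -/
def Buchi.Accepts {A : Type u} {Q : Type v} (B : Buchi A Q) (α : ℕ → A) : Prop :=
  ∃ r : ℕ → Q, r 0 ∈ B.start ∧ (∀ n, (r n, α n, r (n + 1)) ∈ B.trans) ∧
    ∀ N, ∃ n, N ≤ n ∧ r n ∈ B.accept

/-! ### ω-semigroups -/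

/-- The non-empty product `x i * x (i+1) * ⋯ * x (i+n)` in a semigroup. -/
def blockProd {S : Type u} [Semigroup S] (x : ℕ → S) (i : ℕ) : ℕ → S
  | 0 => x i
  | n + 1 => blockProd x i n * x (i + n + 1)

/-- An ω-semigroup: a semigroup `F`, a set `I`, a mixed product `F × I → I` and an infinite product
of sequences over `F` with values in `I`, subject to the associativity laws. -/
structure OmegaSemigroup where
  F : Type u
  I : Type v
  [semigroup : Semigroup F]
  mix : F → I → I
  prod : (ℕ → F) → I
  mix_assoc : ∀ (x y : F) (z : I), mix (x * y) z = mix x (mix y z)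
  prod_block : ∀ (x : ℕ → F) (k : ℕ → ℕ), StrictMono k →
    prod x = prod (fun n => Nat.casesOn n (blockProd x 0 (k 0))
      (fun i => blockProd x (k i + 1) (k (i + 1) - k i - 1)))
  mix_prod : ∀ (y : F) (x : ℕ → F), mix y (prod x) = prod (fun n => Nat.casesOn n y x)

attribute [instance] OmegaSemigroup.semigroup

/-- The language `L` of infinite words is recognised by the morphism from the ω-semigroup of words
over `A` into `M` with letter images `h`, through the set `H`. (Morphisms into `M` correspond
exactly to the maps `A → M.F`.) -/
def Recognises {A : Type u} (M : OmegaSemigroup.{v, w}) (h : A → M.F) (H : Set M.I)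
    (L : Set (ℕ → A)) : Prop :=
  ∀ α : ℕ → A, α ∈ L ↔ M.prod (fun n => h (α n)) ∈ H

/-! ### The equivalence of substitutions modulo an ω-semigroup -/

open Classical in
/-- `splitNew seen x` is the pair `(v₀, [(b₁, v₁), …, (b_d, v_d)])` with `x = v₀ b₁ v₁ ⋯ b_d v_d`,
where `b₁, …, b_d` are the first occurrences in `x` of the letters of `x` that are not in `seen`. -/
noncomputable def splitNew {A : Type u} : List A → List A → List A × List (A × List A)
  | _, [] => ([], [])
  | seen, c :: x =>
    if c ∈ seen then (c :: (splitNew seen x).1, (splitNew seen x).2)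
    else ([], (c, (splitNew (c :: seen) x).1) :: (splitNew (c :: seen) x).2)

/-- The factorisation `x = b₁ v₁ ⋯ b_d v_d` of a word at the first occurrence of each of its
letters, as the list of the pairs `(b_i, v_i)`. -/
noncomputable def firstOccurrences {A : Type u} (x : List A) : List (A × List A) :=
  (splitNew [] x).2

/-- The value of a finite word under the morphism with letter images `h`, in the monoid obtained by
adjoining a fresh neutral element (the value of the empty word). -/
def evalWord {A : Type u} (M : OmegaSemigroup.{v, w}) (h : A → M.F) (x : List A) : WithOne M.F :=
  (x.map (fun a => (h a : WithOne M.F))).prod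

/-- The function `segments_σ`. -/
noncomputable def segments {A : Type u} (M : OmegaSemigroup.{v, w}) (σ : Substitution A)
    (a : A) (h : A → M.F) : List (A × WithOne M.F) :=
  (firstOccurrences (σ.img a)).map (fun p => (p.1, evalWord M h p.2))

/-- Two substitutions are equivalent if they have the same segments. -/
def segmentsSetoid (A : Type u) (M : OmegaSemigroup.{v, w}) : Setoid (Substitution A) where
  r σ μ := segments M σ = segments M μ
  iseqv := ⟨fun _ => rfl, fun h => h.symm, fun h h' => h.trans h'⟩

/-- The set `Ξ` of classes of substitutions. -/
def Xi (A : Type u) (M : OmegaSemigroup.{v, w}) : Type u :=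
  Quotient (segmentsSetoid A M)

/-- The class of a substitution. -/
def Xi.mk {A : Type u} (M : OmegaSemigroup.{v, w}) (σ : Substitution A) : Xi A M :=
  Quotient.mk (segmentsSetoid A M) σ

/-- The trace of a directive sequence. -/
def trace {A : Type u} (M : OmegaSemigroup.{v, w}) (s : ℕ → Substitution A) : ℕ → Xi A M :=
  fun n => Xi.mk M (s n)

/-! ### Finite representations, used as inputs and outputs of algorithms

Finite sets are enumerated by equivalences with `Fin n`; elements are represented by numbers. -/

/-- A finite word, represented by the list of the numbers of its letters. -/
def wordCode {A : Type u} {k : ℕ} (e : A ≃ Fin k) (x : List A) : List ℕ :=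
  x.map (fun a => (e a : ℕ))

/-- Representations of substitutions. -/
abbrev SubstCode := List (List ℕ)

/-- A substitution, represented by the list of the images of the letters. -/
def substCode {A : Type u} {k : ℕ} (e : A ≃ Fin k) (σ : Substitution A) : SubstCode :=
  List.ofFn (fun i : Fin k => wordCode e (σ.img (e.symm i)))

/-- Representations of Büchi automata whose letters are represented by elements of `C`: the number
of states, the initial states, the transitions, the accepting states. -/
abbrev BuchiCode (C : Type) := ℕ × List ℕ × List (ℕ × C × ℕ) × List ℕ

/-- The automaton with state set `{0, …, n-1}` represented by `b`, where `rep c a` says that `c`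
represents the letter `a`. -/
def BuchiCode.toBuchi {C : Type} {A : Type u} (b : BuchiCode C) (rep : C → A → Prop) :
    Buchi A (Fin b.1) where
  start := {q | (q : ℕ) ∈ b.2.1}
  trans := {t | ∃ c, ((t.1 : ℕ), c, (t.2.2 : ℕ)) ∈ b.2.2.1 ∧ rep c t.2.1}
  accept := {q | (q : ℕ) ∈ b.2.2.2}

/-- The Büchi automaton over `A` represented by `b`. -/
def automatonOver {A : Type u} {k : ℕ} (e : A ≃ Fin k) (b : BuchiCode ℕ) : Buchi A (Fin b.1) :=
  b.toBuchi (fun c a => c = (e a : ℕ))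

/-- The Büchi automaton over the alphabet `Ξ` represented by `b`: a letter of `Ξ` is represented by
any substitution in that class. -/
def automatonOverXi {A : Type u} {k : ℕ} (e : A ≃ Fin k) (M : OmegaSemigroup.{v, w})
    (b : BuchiCode SubstCode) : Buchi (Xi A M) (Fin b.1) :=
  b.toBuchi (fun c ξ => ∃ σ : Substitution A, c = substCode e σ ∧ Xi.mk M σ = ξ)

/-- The Büchi automaton over the alphabet of the substitutions in the finite list `S` represented
by `b`. -/
def automatonOverList {A : Type u} {k : ℕ} (e : A ≃ Fin k) (S : List (Substitution A))
    (b : BuchiCode SubstCode) : Buchi {σ // σ ∈ S} (Fin b.1) :=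
  b.toBuchi (fun c σ => c = substCode e σ.1)

/-- Representations of a morphism into a finite ω-semigroup with a set of accepted values: the sizes
of `A`, `M.F`, `M.I`, the tables of the product, of the mixed product and of `x ↦ x^ω = x x x ⋯`
(which determines the infinite product of a finite ω-semigroup), the images of the letters, and the
characteristic list of the accepting set. -/
abbrev RecCode :=
  ℕ × ℕ × ℕ × List (List ℕ) × List (List ℕ) × List ℕ × List ℕ × List Bool

open Classical in
/-- The representation of `h : A → M.F` and `H ⊆ M.I`, for enumerations of `A`, `M.F`, `M.I`. -/
noncomputable def recCode {A : Type u} {k m p : ℕ} (e : A ≃ Fin k) (M : OmegaSemigroup.{v, w})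
    (eF : M.F ≃ Fin m) (eI : M.I ≃ Fin p) (h : A → M.F) (H : Set M.I) : RecCode :=
  (k, m, p,
    List.ofFn (fun i => List.ofFn (fun j => (eF (eF.symm i * eF.symm j) : ℕ))),
    List.ofFn (fun i => List.ofFn (fun j => (eI (M.mix (eF.symm i) (eI.symm j)) : ℕ))),
    List.ofFn (fun i => (eI (M.prod (fun _ => eF.symm i)) : ℕ)),
    List.ofFn (fun i => (eF (h (e.symm i)) : ℕ)),
    List.ofFn (fun j => decide (eI.symm j ∈ H)))

/-! ### Segments of words -/

section Segments

variable {A : Type u} {M : OmegaSemigroup.{v, w}}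

/-! Write `h_n = h ∘ σ_0 ∘ ⋯ ∘ σ_{n-1}`. Suppose finite words `x_n` satisfy `x_0 = []` and
`σ_n(x_{n+1}) = x_n r_n`, with `r_n` non-empty infinitely often. In the limit they define a directed
word `α` (`exists_directs`), which is the concatenation of the words `σ_0 ⋯ σ_{n-1}(r_n)`; its value
is therefore governed by the elements `h_n(r_n)`. The automaton has to guess such a sequence with
finite memory.

Every directed word arises in this way. Call a prefix of `α^(n)` stable if from the level `n` on the
substitutions act letter by letter on the prefixes of that length. If stable prefixes become
arbitrarily long, let `x_n` be a stable prefix that grows by at most one letter per level. Otherwise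
their length stops at some `j`; from some level on, the letter at position `j` is the first letter
of the image of the letter at position `j` one level up, infinitely often with a non-empty rest, so
that it generates the remainder of `α` (`exists_followStep`). Of a stable prefix only the set of
letters need be remembered: if each letter of the set is the image of a letter in the next set, then
all words over the set lift (`FollowStep.exists_lift`). A state is thus `h_n`, a set of letters and
at most one generating letter. A second component guesses a Ramsey factorisation of value `x e e e
⋯` and checks that `x e^ω` is accepted (`exists_valueStep`, `prod_mem_of_valueStep`).
`exists_directs_iff` combines both.

A step uses `σ` only through `h ∘ σ` and through the first letter of `σ(a)` with the value of the
rest. Segments determine both (`FollowStep.congr`), so the automaton can read classes. The segments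
of a composition are computable from those of its factors because they are given for all `h` at
once, in particular for `h ∘ σ` (`segGen_onWord`). There are finitely many segment functions, and
cutting out repetitions gives representatives of bounded length (`exists_segEq_length_le`), so the
alphabet can be listed.

An ω-semigroup for a Büchi automaton consists of the sets of triples source, mark, target; its
infinite powers are decided by lassos (`RunSet.mem_omegaProd_const`). All algorithms are primitive
recursive on codes. -/

theorem evalWord_nil (h : A → M.F) : evalWord M h [] = 1 := rfl

theorem evalWord_cons (h : A → M.F) (a : A) (x : List A) :
    evalWord M h (a :: x) = h a * evalWord M h x := by
  simp [evalWord]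

theorem evalWord_append (h : A → M.F) (x y : List A) :
    evalWord M h (x ++ y) = evalWord M h x * evalWord M h y := by
  simp [evalWord]

theorem WithOne.coe_mul_ne_one {S : Type*} [Semigroup S] (a : S) (b : WithOne S) :
    (a : WithOne S) * b ≠ 1 := by
  cases b with
  | one => exact WithOne.coe_ne_one
  | coe b => exact WithOne.coe_ne_one

theorem evalWord_eq_one_iff (h : A → M.F) (x : List A) : evalWord M h x = 1 ↔ x = [] := by
  cases x with
  | nil => simp [evalWord_nil]
  | cons a x => simp [evalWord_cons, WithOne.coe_mul_ne_one]

/-- The morphism `h ∘ σ`, on letters. -/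
noncomputable def pullback (h : A → M.F) (σ : Substitution A) (a : A) : M.F :=
  WithOne.unone (mt (evalWord_eq_one_iff h (σ.img a)).1 (σ.img_ne_nil a))

theorem coe_pullback (h : A → M.F) (σ : Substitution A) (a : A) :
    (pullback h σ a : WithOne M.F) = evalWord M h (σ.img a) :=
  WithOne.coe_unone _

theorem Substitution.onWord_nil (σ : Substitution A) : σ.onWord [] = [] := rfl

theorem Substitution.onWord_cons (σ : Substitution A) (a : A) (x : List A) :
    σ.onWord (a :: x) = σ.img a ++ σ.onWord x := by
  simp [Substitution.onWord]

theorem Substitution.onWord_append (σ : Substitution A) (x y : List A) :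
    σ.onWord (x ++ y) = σ.onWord x ++ σ.onWord y := by
  simp [Substitution.onWord]

theorem Substitution.onWord_id (x : List A) : (Substitution.id A).onWord x = x := by
  simp [Substitution.onWord, Substitution.id]

theorem Substitution.onWord_comp (σ μ : Substitution A) (x : List A) :
    (σ.comp μ).onWord x = σ.onWord (μ.onWord x) := by
  induction x with
  | nil => rfl
  | cons a x ih => simp only [onWord_cons, onWord_append, ih]; rfl

theorem evalWord_pullback (h : A → M.F) (σ : Substitution A) (x : List A) :
    evalWord M (pullback h σ) x = evalWord M h (σ.onWord x) := by
  induction x with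
  | nil => rfl
  | cons a x ih => simp [Substitution.onWord_cons, evalWord_append, evalWord_cons, coe_pullback, ih]

theorem pullback_id (h : A → M.F) : pullback h (Substitution.id A) = h := by
  funext a
  apply WithOne.coe_injective
  simp [coe_pullback, Substitution.id, evalWord_cons, evalWord_nil]

/-- Only the set of seen letters matters, so the list may be reordered or contain repetitions. -/
theorem splitNew_congr {s t : List A} (hst : ∀ a, a ∈ s ↔ a ∈ t) (x : List A) :
    splitNew s x = splitNew t x := by
  induction x generalizing s t with
  | nil => simp [splitNew]
  | cons c x ih =>
    have h₁ := ih hst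
    have h₂ := ih (s := c :: s) (t := c :: t) (by simp [hst])
    by_cases hc : c ∈ s
    · simp [splitNew, hc, (hst c).1 hc, h₁]
    · simp [splitNew, hc, mt (hst c).2 hc, h₂]

/-- The values of the factors of `x` at the first occurrences of the letters not in `seen`. -/
noncomputable def segGen (h : A → M.F) (seen x : List A) :
    WithOne M.F × List (A × WithOne M.F) :=
  (evalWord M h (splitNew seen x).1, (splitNew seen x).2.map fun p => (p.1, evalWord M h p.2))

theorem segGen_congr (h : A → M.F) {s t : List A} (hst : ∀ a, a ∈ s ↔ a ∈ t) (x : List A) :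
    segGen h s x = segGen h t x := by
  simp [segGen, splitNew_congr hst]

theorem segGen_nil (h : A → M.F) (s : List A) : segGen h s [] = (1, []) := by
  simp [segGen, splitNew, evalWord_nil]

theorem segGen_cons_of_mem (h : A → M.F) {s : List A} {c : A} (hc : c ∈ s) (x : List A) :
    segGen h s (c :: x) = (h c * (segGen h s x).1, (segGen h s x).2) := by
  simp [segGen, splitNew, hc, evalWord_cons]

theorem segGen_cons_of_notMem (h : A → M.F) {s : List A} {c : A} (hc : c ∉ s) (x : List A) :
    segGen h s (c :: x) = (1, (c, (segGen h (c :: s) x).1) :: (segGen h (c :: s) x).2) := by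
  simp [segGen, splitNew, hc, evalWord_nil]

/-- Concatenation of values of factorisations. -/
def segCat {W : Type*} [Mul W] : W → List (A × W) → W × List (A × W) → W × List (A × W)
  | w, [], q => (w * q.1, q.2)
  | w, (b, w') :: l, q => (w, (b, (segCat w' l q).1) :: (segCat w' l q).2)

theorem segCat_mul {W : Type*} [Monoid W] (w w' : W) (l : List (A × W)) (q : W × List (A × W)) :
    segCat (w * w') l q = (w * (segCat w' l q).1, (segCat w' l q).2) := by
  cases l with
  | nil => simp [segCat, mul_assoc]
  | cons p l => obtain ⟨b, w''⟩ := p; simp [segCat]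

/-- The letters of `x` count as seen when `y` is read, and the factor of `y` before its first new
letter is merged into the last factor of `x`. -/
theorem segGen_append (h : A → M.F) (s x y : List A) :
    segGen h s (x ++ y) =
      segCat (segGen h s x).1 (segGen h s x).2 (segGen h (s ++ x) y) := by
  induction x generalizing s with
  | nil => simp [segGen_nil, segCat]
  | cons c x ih =>
    by_cases hc : c ∈ s
    · rw [List.cons_append, segGen_cons_of_mem h hc, segGen_cons_of_mem h hc, ih, segCat_mul,
        segGen_congr h (s := s ++ c :: x) (t := s ++ x)]
      intro a
      simp only [List.mem_append, List.mem_cons]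
      constructor
      · rintro (h | rfl | h) <;> simp_all
      · rintro (h | h) <;> simp_all
    · rw [List.cons_append, segGen_cons_of_notMem h hc, segGen_cons_of_notMem h hc, ih, segCat,
        segGen_congr h (s := s ++ c :: x) (t := c :: s ++ x)]
      intro a
      simp only [List.mem_append, List.mem_cons]
      tauto

theorem segGen_of_subset (h : A → M.F) {s x : List A} (hx : ∀ a ∈ x, a ∈ s) :
    segGen h s x = (evalWord M h x, []) := by
  induction x with
  | nil => simp [segGen_nil, evalWord_nil]
  | cons c x ih =>
    rw [segGen_cons_of_mem h (hx c (by simp)), ih fun a ha => hx a (by simp [ha]), evalWord_cons]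

/-- The factorisation of `σ(x)` from that of `x`, where `seen` are the letters known before. -/
noncomputable def segTransfer (h : A → M.F) (σ : Substitution A) :
    List A → WithOne M.F → List (A × WithOne M.F) → WithOne M.F × List (A × WithOne M.F)
  | _, w, [] => (w, [])
  | s, w, (b, w') :: l =>
    segCat w [] (segCat (segGen h s (σ.img b)).1 (segGen h s (σ.img b)).2
      (segTransfer h σ (s ++ σ.img b) w' l))

theorem segTransfer_mul (h : A → M.F) (σ : Substitution A) (s : List A) (w w' : WithOne M.F)
    (l : List (A × WithOne M.F)) :
    segTransfer h σ s (w * w') l =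
      (w * (segTransfer h σ s w' l).1, (segTransfer h σ s w' l).2) := by
  cases l with
  | nil => simp [segTransfer]
  | cons p l => obtain ⟨b, w''⟩ := p; simp [segTransfer, segCat, mul_assoc]

/-- The image of a letter already in `seen` has no new letters and contributes only its value, which
`pullback` records. At a new letter `b` the factorisation of `σ(b)` is spliced in. Hence the
segments of `x` for `h ∘ σ` determine those of `σ(x)` for `h`. -/
theorem segGen_onWord (h : A → M.F) (σ : Substitution A) (seen s x : List A)
    (hs : ∀ a ∈ σ.onWord seen, a ∈ s) :
    segGen h s (σ.onWord x) =
      segTransfer h σ s (segGen (pullback h σ) seen x).1 (segGen (pullback h σ) seen x).2 := by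
  induction x generalizing seen s with
  | nil => simp [Substitution.onWord_nil, segGen_nil, segTransfer]
  | cons c x ih =>
    rw [Substitution.onWord_cons, segGen_append]
    by_cases hc : c ∈ seen
    · have hcs : ∀ a ∈ σ.img c, a ∈ s := fun a ha =>
        hs a (List.mem_flatMap.2 ⟨c, hc, ha⟩)
      rw [segGen_of_subset h hcs, segGen_cons_of_mem _ hc,
        segGen_congr h (s := s ++ σ.img c) (t := s) (fun a => by
          simpa using hcs a), ih seen s hs, segTransfer_mul, segCat, coe_pullback]
    · rw [segGen_cons_of_notMem _ hc, segTransfer, segCat, one_mul, ih (c :: seen)]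
      intro a ha
      rw [Substitution.onWord_cons, List.mem_append] at ha
      rw [List.mem_append]
      exact ha.symm.imp (hs a) fun h => h

theorem evalWord_eq_segGen (h : A → M.F) (s x : List A) :
    evalWord M h x =
      (segGen h s x).1 * ((segGen h s x).2.map fun p => (h p.1 : WithOne M.F) * p.2).prod := by
  induction x generalizing s with
  | nil => simp [segGen_nil, evalWord_nil]
  | cons c x ih =>
    by_cases hc : c ∈ s
    · rw [segGen_cons_of_mem h hc, evalWord_cons, ih s, mul_assoc]
    · rw [segGen_cons_of_notMem h hc, evalWord_cons, ih (c :: s)]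
      simp [mul_assoc]

theorem mem_iff_mem_segGen (h : A → M.F) (s x : List A) (a : A) :
    (a ∈ x ∨ a ∈ s) ↔ (a ∈ (segGen h s x).2.map Prod.fst ∨ a ∈ s) := by
  induction x generalizing s with
  | nil => simp [segGen_nil]
  | cons c x ih =>
    by_cases hc : c ∈ s
    · rw [segGen_cons_of_mem h hc, ← ih s, List.mem_cons]
      constructor
      · rintro ((rfl | h) | h) <;> simp_all
      · tauto
    · rw [segGen_cons_of_notMem h hc]
      have := ih (c :: s)
      simp only [List.mem_cons, List.map_cons] at this ⊢
      tauto

theorem segGen_nil_fst (h : A → M.F) (x : List A) : (segGen h [] x).1 = 1 := by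
  cases x with
  | nil => simp [segGen_nil]
  | cons c x => rw [segGen_cons_of_notMem h (by simp)]

theorem nodup_segGen (h : A → M.F) (s x : List A) :
    ((segGen h s x).2.map Prod.fst).Nodup ∧ ∀ a ∈ (segGen h s x).2.map Prod.fst, a ∉ s := by
  induction x generalizing s with
  | nil => simp [segGen_nil]
  | cons c x ih =>
    by_cases hc : c ∈ s
    · rw [segGen_cons_of_mem h hc]
      exact ih s
    · rw [segGen_cons_of_notMem h hc]
      obtain ⟨h₁, h₂⟩ := ih (c :: s)
      rw [List.map_cons, List.nodup_cons]
      refine ⟨⟨fun hm => h₂ c hm (by simp), h₁⟩, fun a ha => ?_⟩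
      rcases List.mem_cons.1 ha with rfl | ha
      · exact hc
      · exact fun has => h₂ a ha (by simp [has])

/-- The words `x` and `y` have the same segments. -/
def SegEq (M : OmegaSemigroup.{v, w}) (x y : List A) : Prop :=
  ∀ h : A → M.F, segGen h [] x = segGen h [] y

theorem SegEq.evalWord_eq {x y : List A} (hxy : SegEq M x y) (h : A → M.F) :
    evalWord M h x = evalWord M h y := by
  rw [evalWord_eq_segGen h [] x, hxy h, ← evalWord_eq_segGen]

theorem SegEq.mem_iff {x y : List A} (hxy : SegEq M x y) (h : A → M.F) (a : A) :
    a ∈ x ↔ a ∈ y := by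
  have h₁ := mem_iff_mem_segGen h [] x a
  have h₂ := mem_iff_mem_segGen h [] y a
  rw [hxy h, ← h₂] at h₁
  simpa using h₁

/-- The case `σ = id` of `segGen_onWord`: the factorisation with nothing seen determines the one
relative to any `s`. -/
theorem segTransfer_id_segGen (h : A → M.F) (s x : List A) :
    segGen h s x = segTransfer h (Substitution.id A) s (segGen h [] x).1 (segGen h [] x).2 := by
  have := segGen_onWord h (Substitution.id A) [] s x (by simp [Substitution.onWord])
  rwa [pullback_id, Substitution.onWord_id] at this

theorem SegEq.segGen_eq {x y : List A} (hxy : SegEq M x y) (h : A → M.F) (s : List A) :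
    segGen h s x = segGen h s y := by
  rw [segTransfer_id_segGen, hxy h, ← segTransfer_id_segGen]

theorem SegEq.append_right {x y : List A} (hxy : SegEq M x y) (z : List A) :
    SegEq M (x ++ z) (y ++ z) := fun h => by
  rw [segGen_append, segGen_append, hxy h,
    segGen_congr h (s := [] ++ x) (t := [] ++ y) (by simpa using hxy.mem_iff h)]

theorem SegEq.onWord {x y : List A} (hxy : SegEq M x y) (σ : Substitution A) :
    SegEq M (σ.onWord x) (σ.onWord y) := fun h => by
  rw [segGen_onWord h σ [] [] x (by simp [Substitution.onWord]),
    segGen_onWord h σ [] [] y (by simp [Substitution.onWord]), hxy]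

/-! ### Classes of substitutions and their monoid -/

theorem segments_eq_segGen (σ : Substitution A) (a : A) (h : A → M.F) :
    segments M σ a h = (segGen h [] (σ.img a)).2 := rfl

theorem Xi.mk_eq_iff {σ μ : Substitution A} :
    Xi.mk M σ = Xi.mk M μ ↔ ∀ a, SegEq M (σ.img a) (μ.img a) := by
  constructor
  · intro hσ a h
    replace hσ := Quotient.exact hσ
    have : segments M σ a h = segments M μ a h := congrFun (congrFun hσ a) h
    rw [segments_eq_segGen, segments_eq_segGen] at this
    -- With nothing seen, the factor before the first new letter is empty, so the list of segments
    -- carries all the information.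
    exact Prod.ext (by rw [segGen_nil_fst, segGen_nil_fst]) this
  · intro hσ
    refine Quotient.sound (?_ : segments M σ = segments M μ)
    funext a h
    rw [segments_eq_segGen, segments_eq_segGen, hσ a h]

theorem pullback_congr {σ μ : Substitution A} (hσ : Xi.mk M σ = Xi.mk M μ) (h : A → M.F) :
    pullback h σ = pullback h μ := by
  funext a
  apply WithOne.coe_injective
  rw [coe_pullback, coe_pullback, (Xi.mk_eq_iff.1 hσ a).evalWord_eq]

theorem segTransfer_congr {σ μ : Substitution A} (hσ : Xi.mk M σ = Xi.mk M μ) (h : A → M.F)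
    {s t : List A} (hst : ∀ a, a ∈ s ↔ a ∈ t) (w : WithOne M.F) (l : List (A × WithOne M.F)) :
    segTransfer h σ s w l = segTransfer h μ t w l := by
  induction l generalizing s t w with
  | nil => simp [segTransfer]
  | cons p l ih =>
    obtain ⟨b, w'⟩ := p
    have hb := Xi.mk_eq_iff.1 hσ b
    rw [segTransfer, segTransfer, segGen_congr h hst, hb.segGen_eq,
      ih (s := s ++ σ.img b) (t := t ++ μ.img b)]
    intro a
    simp [hst, hb.mem_iff h]

theorem SegEq.onWord_congr {σ μ : Substitution A} (hσ : Xi.mk M σ = Xi.mk M μ) (x : List A) :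
    SegEq M (σ.onWord x) (μ.onWord x) := fun h => by
  rw [segGen_onWord h σ [] [] x (by simp [Substitution.onWord]),
    segGen_onWord h μ [] [] x (by simp [Substitution.onWord]), pullback_congr hσ,
    segTransfer_congr hσ h fun _ => Iff.rfl]

theorem SegEq.trans {x y z : List A} (h₁ : SegEq M x y) (h₂ : SegEq M y z) : SegEq M x z :=
  fun h => (h₁ h).trans (h₂ h)

/-- The classes of substitutions form a monoid under composition. -/
theorem exists_monoid_Xi (A : Type u) (M : OmegaSemigroup.{v, w}) :
    ∃ _ : Monoid (Xi A M), Xi.mk M (Substitution.id A) = 1 ∧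
      ∀ σ μ : Substitution A, Xi.mk M (σ.comp μ) = Xi.mk M σ * Xi.mk M μ := by
  -- Well-definedness: `μ` is replaced under a fixed `σ` because substitutions preserve `SegEq`, and
  -- `σ` is replaced on a fixed word by `SegEq.onWord_congr`.
  let mul : Xi A M → Xi A M → Xi A M := Quotient.map₂ Substitution.comp
    (fun σ σ' hσ μ μ' hμ => Quotient.exact (Xi.mk_eq_iff.2 fun a =>
      SegEq.trans ((Xi.mk_eq_iff.1 (Quotient.sound hμ) a).onWord σ)
        (SegEq.onWord_congr (Quotient.sound hσ) (μ'.img a))))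
  refine ⟨{ mul := mul
            one := Xi.mk M (Substitution.id A)
            mul_assoc := ?_
            one_mul := ?_
            mul_one := ?_ }, rfl, fun _ _ => rfl⟩
  · rintro ⟨σ⟩ ⟨μ⟩ ⟨τ⟩
    refine congrArg (Xi.mk M) (Substitution.ext (funext fun a => ?_))
    exact Substitution.onWord_comp σ μ (τ.img a)
  · rintro ⟨σ⟩
    exact congrArg (Xi.mk M) (Substitution.ext (funext fun a => Substitution.onWord_id (σ.img a)))
  · rintro ⟨σ⟩
    refine congrArg (Xi.mk M) (Substitution.ext (funext fun a => ?_))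
    change σ.onWord [a] = σ.img a
    simp [Substitution.onWord]

/-! ### Finiteness of the set of classes and short representatives -/

theorem length_segGen_le [Finite A] (h : A → M.F) (x : List A) :
    (segGen h [] x).2.length ≤ Nat.card A := by
  classical
  have := Fintype.ofFinite A
  rw [← List.length_map Prod.fst, Nat.card_eq_fintype_card]
  exact (nodup_segGen h [] x).1.length_le_card

/-- A list of at most `k` elements as a function on `Fin k`. -/
def paddedList {B : Type*} (k : ℕ) (l : List B) (i : Fin k) : Option B := l[(i : ℕ)]?

theorem paddedList_injOn {B : Type*} {k : ℕ} {l l' : List B} (hl : l.length ≤ k)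
    (hl' : l'.length ≤ k) (h : paddedList k l = paddedList k l') : l = l' := by
  apply List.ext_getElem?
  intro i
  by_cases hi : i < k
  · exact congrFun h ⟨i, hi⟩
  · rw [List.getElem?_eq_none (by omega), List.getElem?_eq_none (by omega)]

/-- The segments of a word, in a finite type. -/
noncomputable def segCode [Finite A] (x : List A) (h : A → M.F) :
    Fin (Nat.card A) → Option (A × WithOne M.F) :=
  paddedList _ (segGen h [] x).2

theorem segCode_eq_iff [Finite A] {x y : List A} :
    segCode (M := M) x = segCode y ↔ SegEq M x y := by
  constructor
  · intro hxy h
    refine Prod.ext (by rw [segGen_nil_fst, segGen_nil_fst]) ?_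
    exact paddedList_injOn (length_segGen_le h x) (length_segGen_le h y) (congrFun hxy h)
  · intro hxy
    funext h
    rw [segCode, segCode, hxy h]

instance [Finite M.F] : Finite (WithOne M.F) := inferInstanceAs (Finite (Option M.F))

theorem finite_Xi [Finite A] [Finite M.F] : Finite (Xi A M) := by
  refine Finite.of_injective
    (fun ξ : Xi A M => fun a => segCode (M := M) ((Quotient.out ξ).img a)) fun ξ ζ hξ => ?_
  have : Xi.mk M (Quotient.out ξ) = Xi.mk M (Quotient.out ζ) :=
    Xi.mk_eq_iff.2 fun a => segCode_eq_iff.1 (congrFun hξ a)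
  exact (Quotient.out_eq ξ).symm.trans (this.trans (Quotient.out_eq ζ))

/-- A bound for the number of classes of words, for `k` letters and `m` values. -/
def segBound (k m : ℕ) : ℕ := ((k * (m + 1) + 1) ^ k) ^ (m ^ k)

/-- Take a shortest equivalent word `y`. If `y` is longer than the number of codes, two of its
prefixes have the same code; `SegEq` is compatible with appending on the right, so replacing the
longer prefix by the shorter one contradicts minimality. -/
theorem exists_segEq_length_le [Finite A] [Finite M.F] (x : List A) :
    ∃ y, SegEq M x y ∧ y.length ≤ segBound (Nat.card A) (Nat.card M.F) := by
  classical
  have := Fintype.ofFinite A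
  have := Fintype.ofFinite M.F
  have hex : ∃ n, ∃ y, SegEq M x y ∧ y.length = n := ⟨_, x, fun _ => rfl, rfl⟩
  obtain ⟨y, hy, hlen⟩ := Nat.find_spec hex
  refine ⟨y, hy, ?_⟩
  by_contra hlt
  rw [not_le] at hlt
  have hcard : Nat.card ((A → M.F) → Fin (Nat.card A) → Option (A × WithOne M.F)) =
      segBound (Nat.card A) (Nat.card M.F) := by
    have hW : Nat.card (WithOne M.F) = Nat.card M.F + 1 := Finite.card_option
    rw [Nat.card_fun, Nat.card_fun, Finite.card_option, Nat.card_prod, hW, Nat.card_fun,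
      Nat.card_fin, segBound]
  have : ¬ Function.Injective
      (fun i : Fin (y.length + 1) => segCode (M := M) (y.take i)) := fun hinj => by
    have := Nat.card_le_card_of_injective _ hinj
    rw [hcard, Nat.card_fin] at this
    omega
  rw [Function.Injective] at this
  push Not at this
  obtain ⟨i, j, hij, hne⟩ := this
  have key : ∀ i j : Fin (y.length + 1), segCode (M := M) (y.take i) = segCode (y.take j) →
      i < j → False := by
    intro i j hij hlt
    have hs := (segCode_eq_iff.1 hij).append_right (y.drop j)
    rw [List.take_append_drop] at hs
    refine Nat.find_min hex (m := (y.take i ++ y.drop j).length) ?_ ⟨_, ?_, rfl⟩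
    · rw [← hlen, List.length_append, List.length_take, List.length_drop]
      have := i.2
      have := j.2
      have : (i : ℕ) < j := hlt
      omega
    · exact fun h => (hy h).trans (hs h).symm
  rcases lt_or_gt_of_ne hne with h | h
  · exact key i j hij h
  · exact key j i hij.symm h

/-- The morphism `h` serves to show that the short words are non-empty: if there were no map `A →
M.F`, all words would be equivalent. -/
theorem exists_mk_eq_length_le [Finite A] [Finite M.F] (h : A → M.F) (σ : Substitution A) :
    ∃ μ : Substitution A, Xi.mk M σ = Xi.mk M μ ∧
      ∀ a, (μ.img a).length ≤ segBound (Nat.card A) (Nat.card M.F) := by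
  choose y hy hlen using fun a => exists_segEq_length_le (M := M) (σ.img a)
  refine ⟨⟨y, fun a ha => σ.img_ne_nil a ?_⟩, Xi.mk_eq_iff.2 hy, hlen⟩
  rw [← evalWord_eq_one_iff h, (hy a).evalWord_eq, ha, evalWord_nil]

/-- The image of `a` begins with `b`, followed by a word of value `z`. -/
def HeadTail (σ : Substitution A) (h : A → M.F) (a b : A) (z : WithOne M.F) : Prop :=
  ∃ x, σ.img a = b :: x ∧ z = evalWord M h x

/-- The first letter of the image is the letter of the first segment. The value of the rest is the
product of what remains of the segments, which is the factorisation of the rest relative to `[b]`.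
-/
theorem HeadTail.congr {σ μ : Substitution A} (hσ : Xi.mk M σ = Xi.mk M μ) {h : A → M.F}
    {a b : A} {z : WithOne M.F} (H : HeadTail σ h a b z) : HeadTail μ h a b z := by
  obtain ⟨x, hx, rfl⟩ := H
  obtain ⟨c, y, hy⟩ := List.exists_cons_of_ne_nil (μ.img_ne_nil a)
  have := Xi.mk_eq_iff.1 hσ a h
  rw [hx, hy, segGen_cons_of_notMem h (by simp), segGen_cons_of_notMem h (by simp)] at this
  simp only [Prod.mk.injEq, List.cons.injEq, true_and] at this
  obtain ⟨⟨rfl, h₁⟩, h₂⟩ := this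
  refine ⟨y, hy, ?_⟩
  rw [evalWord_eq_segGen h [b] x, h₁, h₂, ← evalWord_eq_segGen]

theorem headTail_one_iff {σ : Substitution A} {h : A → M.F} {a b : A} :
    HeadTail σ h a b 1 ↔ σ.img a = [b] := by
  constructor
  · rintro ⟨x, hx, h1⟩
    rw [hx, (evalWord_eq_one_iff h x).1 h1.symm]
  · intro hx
    exact ⟨[], hx, rfl⟩

end Segments

/-! ### Factors of infinite words and factorisations in finite ω-semigroups -/

section Factors

variable {A : Type u} {M : OmegaSemigroup.{v, w}}

/-- The factor `α(i) ⋯ α(j-1)` of an infinite word. -/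
def factor (α : ℕ → A) (i j : ℕ) : List A := (List.range' i (j - i)).map α

theorem wordPrefix_eq_factor (α : ℕ → A) (n : ℕ) : wordPrefix α n = factor α 0 n := by
  simp [wordPrefix, factor, List.range_eq_range']

theorem factor_append (α : ℕ → A) {i j k : ℕ} (hij : i ≤ j) (hjk : j ≤ k) :
    factor α i j ++ factor α j k = factor α i k := by
  rw [factor, factor, factor, ← List.map_append]
  congr 1
  have := List.range'_append_1 (s := i) (m := j - i) (n := k - j)
  rwa [show i + (j - i) = j by omega, show j - i + (k - j) = k - i by omega] at this

theorem factor_self (α : ℕ → A) (i : ℕ) : factor α i i = [] := by simp [factor]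

theorem factor_eq_nil_iff (α : ℕ → A) {i j : ℕ} : factor α i j = [] ↔ j ≤ i := by
  simp [factor, Nat.sub_eq_zero_iff_le]

theorem length_factor (α : ℕ → A) (i j : ℕ) : (factor α i j).length = j - i := by simp [factor]

theorem factor_succ (α : ℕ → A) (i : ℕ) : factor α i (i + 1) = [α i] := by
  simp [factor]

theorem evalWord_factor (h : A → M.F) (α : ℕ → A) (i n : ℕ) :
    evalWord M h (factor α i (i + n + 1)) = (blockProd (fun l => h (α l)) i n : M.F) := by
  induction n with
  | zero => simp [factor_succ, evalWord_cons, evalWord_nil, blockProd]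
  | succ n ih =>
    rw [← factor_append α (j := i + n + 1) (by omega) (by omega), evalWord_append, ih,
      ← Nat.add_assoc, factor_succ, evalWord_cons, evalWord_nil, mul_one, blockProd,
      WithOne.coe_mul]

theorem coe_eq_evalWord_factor {h : A → M.F} {α : ℕ → A} {i j : ℕ} {x : M.F}
    (hx : evalWord M h (factor α i j) = x) :
    i < j ∧ x = blockProd (fun l => h (α l)) i (j - i - 1) := by
  have hij : i < j := by
    by_contra hij
    rw [(factor_eq_nil_iff α).2 (by omega), evalWord_nil] at hx
    exact WithOne.coe_ne_one hx.symm
  refine ⟨hij, WithOne.coe_injective ?_⟩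
  rw [← evalWord_factor, ← hx, show i + (j - i - 1) + 1 = j by omega]

/-- The value of an infinite word that is factorised into a word of value `x` and words of
value `e`. -/
theorem prod_eq_mix (h : A → M.F) (α : ℕ → A) (t : ℕ → ℕ) (x e : M.F)
    (hx : evalWord M h (factor α 0 (t 0)) = x)
    (he : ∀ n, evalWord M h (factor α (t n) (t (n + 1))) = e) :
    M.prod (fun n => h (α n)) = M.mix x (M.prod fun _ => e) := by
  have h0 := coe_eq_evalWord_factor hx
  have hs := fun n => coe_eq_evalWord_factor (he n)
  -- `prod_block` is indexed by the last positions of the blocks, hence `t n - 1`. All `t n` are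
  -- positive because `x` and `e` lie in `M.F` and are not the adjoined neutral element.
  rw [M.prod_block _ (fun n => t n - 1) (strictMono_nat_of_lt_succ fun n => ?_), M.mix_prod]
  · congr 1
    funext n
    cases n with
    | zero => simp [h0.2]
    | succ n =>
      have hpos : 0 < t n := by
        induction n with
        | zero => exact h0.1
        | succ n ih => exact ih.trans (hs n).1
      have h1 := hs n
      simp only
      rw [h1.2]
      congr 1
      · omega
      · omega
  · have hpos : 0 < t n := by
      induction n with
      | zero => exact h0.1
      | succ n ih => exact ih.trans (hs n).1
    have := (hs n).1
    omega

/-- A colouring of the pairs of natural numbers with finitely many colours has an infinite path of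
one colour, starting arbitrarily late. -/
theorem exists_strictMono_colour {C : Type*} [Finite C] (c : ℕ → ℕ → C) (n₀ : ℕ) :
    ∃ (e : C) (f : ℕ → ℕ), StrictMono f ∧ n₀ ≤ f 0 ∧ ∀ n, c (f n) (f (n + 1)) = e := by
  -- For a non-principal ultrafilter, `g i` is the colour of `(i, j)` for almost all `j`, and `e` is
  -- the value of `g` almost everywhere. From any `i` with `g i = e`, almost every `j` is a possible
  -- next vertex. Only consecutive pairs are controlled, which suffices for a factorisation `x e e e
  -- ⋯`.
  have hcol : ∀ g : ℕ → C, ∃ e, ∀ᶠ j in (Filter.hyperfilter ℕ : Filter ℕ), g j = e := by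
    intro g
    obtain ⟨e, he⟩ := Ultrafilter.eventually_exists_iff
      (P := fun e j => g j = e) (f := Filter.hyperfilter ℕ) |>.1
      (Filter.Eventually.of_forall fun j => ⟨g j, rfl⟩)
    exact ⟨e, he⟩
  choose g hg using fun i => hcol (c i)
  obtain ⟨e, he⟩ := hcol g
  have hlarge : ∀ n, ∀ᶠ j in (Filter.hyperfilter ℕ : Filter ℕ), n < j := fun n =>
    Filter.Eventually.filter_mono (Filter.hyperfilter_le_cofinite) (by
      rw [Nat.cofinite_eq_atTop]; exact Filter.eventually_gt_atTop n)
  obtain ⟨i₀, hi₀, hn₀⟩ := (he.and (hlarge n₀)).exists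
  have hnext : ∀ i : {i // g i = e}, ∃ j : {i // g i = e}, i.1 < j.1 ∧ c i.1 j.1 = e := by
    rintro ⟨i, hi⟩
    obtain ⟨j, ⟨hj, hij⟩, hc⟩ := ((he.and (hlarge i)).and (hg i)).exists
    exact ⟨⟨j, hj⟩, hij, hc.trans hi⟩
  choose next hlt hc using hnext
  refine ⟨e, fun n => (next^[n] ⟨i₀, hi₀⟩).1, strictMono_nat_of_lt_succ fun n => ?_, hn₀.le,
    fun n => ?_⟩
  · rw [Function.iterate_succ_apply']
    exact hlt _
  · simp only [Function.iterate_succ_apply']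
    exact hc _

/-! ### A Büchi condition for the value of an infinite word -/

/-- The states that check the value of an infinite word: the value of the factor read since the last
reset, the guessed period, and whether a period has just been completed. -/
abbrev ValueState (M : OmegaSemigroup.{v, w}) := WithOne M.F × Option M.F × Bool

/-- The transitions when reading a word of value `z`. -/
def ValueStep (H : Set M.I) (s : ValueState M) (z : WithOne M.F) (s' : ValueState M) : Prop :=
  s' = (s.1 * z, s.2.1, false) ∨
  (s.2.1 = none ∧ ∃ x e : M.F, s.1 * z = x ∧ M.mix x (M.prod fun _ => e) ∈ H ∧
    s' = (1, some e, false)) ∨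
  (∃ e : M.F, s.2.1 = some e ∧ s.1 * z = e ∧ s' = (1, some e, true))

/-- If all values were `1` from `N` on, the accumulated value would stay `1` after a reset, while
completing a period needs a value in `M.F`. Thus acceptance forces the followed words to grow
forever. -/
theorem exists_ne_one_of_valueStep {H : Set M.I} {s : ℕ → ValueState M} {z : ℕ → WithOne M.F}
    (hs : ∀ n, ValueStep H (s n) (z n) (s (n + 1))) (hacc : ∀ N, ∃ n, N ≤ n ∧ (s n).2.2 = true)
    (N : ℕ) : ∃ n, N ≤ n ∧ z n ≠ 1 := by
  by_contra hN
  push Not at hN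
  obtain ⟨n₀, hn₀, hf⟩ := hacc (N + 1)
  obtain ⟨n₀, rfl⟩ : ∃ n, n₀ = n + 1 := ⟨n₀ - 1, by omega⟩
  have hreset : ∃ e, (s (n₀ + 1)).1 = 1 ∧ (s (n₀ + 1)).2.1 = some e := by
    rcases hs n₀ with h | ⟨-, x, e, -, -, h⟩ | ⟨e, -, -, h⟩
    · simp [h] at hf
    · simp [h] at hf
    · exact ⟨e, by simp [h]⟩
  obtain ⟨e, he⟩ := hreset
  have hinv : ∀ k, (s (n₀ + 1 + k)).1 = 1 ∧ (s (n₀ + 1 + k)).2.1 = some e := by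
    intro k
    induction k with
    | zero => exact he
    | succ k ih =>
      have hz := hN (n₀ + 1 + k) (by omega)
      rcases hs (n₀ + 1 + k) with h | ⟨h, -⟩ | ⟨e', h₁, h₂, h⟩
      · rw [← Nat.add_assoc, h]
        simp [ih, hz]
      · simp [ih] at h
      · rw [ih.1, hz, one_mul] at h₂
        exact absurd h₂.symm WithOne.coe_ne_one
  obtain ⟨n₁, hn₁, hf₁⟩ := hacc (n₀ + 2)
  obtain ⟨k, rfl⟩ : ∃ k, n₁ = n₀ + 1 + k + 1 := ⟨n₁ - n₀ - 2, by omega⟩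
  have hz := hN (n₀ + 1 + k) (by omega)
  rcases hs (n₀ + 1 + k) with h | ⟨h, -⟩ | ⟨e', h₁, h₂, h⟩
  · simp [h] at hf₁
  · simp [hinv] at h
  · rw [(hinv k).1, hz, one_mul] at h₂
    exact absurd h₂.symm WithOne.coe_ne_one

/-- Until the period is guessed, the state holds the value of the whole prefix; thereafter each
raised flag completes a factor of value `e`. This cuts the word as `x e e e ⋯`. The cutting points
need only be monotone since some steps read the empty word. -/
theorem prod_mem_of_valueStep {H : Set M.I} {s : ℕ → ValueState M} {z : ℕ → WithOne M.F}
    (h : A → M.F) (α : ℕ → A) {t : ℕ → ℕ} (ht : Monotone t) (ht0 : t 0 = 0)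
    (hz : ∀ n, z n = evalWord M h (factor α (t n) (t (n + 1))))
    (hs0 : s 0 = (1, none, false)) (hs : ∀ n, ValueStep H (s n) (z n) (s (n + 1)))
    (hacc : ∀ N, ∃ n, N ≤ n ∧ (s n).2.2 = true) :
    M.prod (fun n => h (α n)) ∈ H := by
  have hsome : ∃ n, (s n).2.1 ≠ none := by
    obtain ⟨n, hn, hf⟩ := hacc 1
    obtain ⟨n, rfl⟩ : ∃ k, n = k + 1 := ⟨n - 1, by omega⟩
    refine ⟨n + 1, ?_⟩
    rcases hs n with h | ⟨-, x, e, -, -, h⟩ | ⟨e, -, -, h⟩ <;> simp [h] at hf ⊢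
  classical
  obtain ⟨N, hN⟩ : ∃ N, Nat.find hsome = N + 1 := by
    refine ⟨Nat.find hsome - 1, ?_⟩
    have : Nat.find hsome ≠ 0 := fun h0 => Nat.find_spec hsome (by rw [h0, hs0])
    omega
  have hbefore : ∀ n, n ≤ N → (s n).2.1 = none ∧ (s n).1 = evalWord M h (factor α 0 (t n)) := by
    intro n
    induction n with
    | zero => intro _; simp [hs0, ht0, factor_self, evalWord_nil]
    | succ n ih =>
      intro hn
      have hnone : (s (n + 1)).2.1 = none := by
        have := Nat.find_min hsome (m := n + 1) (by omega)
        simpa using this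
      refine ⟨hnone, ?_⟩
      rcases hs n with h' | ⟨-, x, e, -, -, h'⟩ | ⟨e, -, -, h'⟩
      · rw [h', (ih (by omega)).2, hz, ← evalWord_append,
          factor_append α (Nat.zero_le _) (ht (by omega))]
      · simp [h'] at hnone
      · simp [h'] at hnone
  have hNs : ∃ x e : M.F, evalWord M h (factor α 0 (t (N + 1))) = x ∧
      M.mix x (M.prod fun _ => e) ∈ H ∧ s (N + 1) = (1, some e, false) := by
    have hne := Nat.find_spec hsome
    rw [hN] at hne
    rcases hs N with h' | ⟨-, x, e, hx, hH, h'⟩ | ⟨e, h', -⟩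
    · rw [h'] at hne
      exact absurd (hbefore N le_rfl).1 hne
    · refine ⟨x, e, ?_, hH, h'⟩
      rw [← hx, (hbefore N le_rfl).2, hz, ← evalWord_append,
        factor_append α (Nat.zero_le _) (ht (by omega))]
    · rw [(hbefore N le_rfl).1] at h'
      simp at h'
  obtain ⟨x, e, hx, hH, hsN⟩ := hNs
  -- Between a reset and the next raised flag the value accumulates without interruption.
  have hnext : ∀ i : {i // (s i).1 = 1 ∧ (s i).2.1 = some e},
      ∃ j : {i // (s i).1 = 1 ∧ (s i).2.1 = some e},
        evalWord M h (factor α (t i.1) (t j.1)) = e := by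
    rintro ⟨i, hi, hie⟩
    have hex : ∃ n, (s (i + n + 1)).2.2 = true := by
      obtain ⟨n, hn, hf⟩ := hacc (i + 1)
      exact ⟨n - i - 1, by rwa [show i + (n - i - 1) + 1 = n by omega]⟩
    have hinv : ∀ n, n ≤ Nat.find hex →
        (s (i + n)).2.1 = some e ∧ (s (i + n)).1 = evalWord M h (factor α (t i) (t (i + n))) := by
      intro n
      induction n with
      | zero => intro _; exact ⟨hie, by simp [hi, factor_self, evalWord_nil]⟩
      | succ n ih =>
        intro hn
        have hf := Nat.find_min hex (m := n) (by omega)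
        have ih := ih (by omega)
        rcases hs (i + n) with h' | ⟨h', -⟩ | ⟨e', h₁, h₂, h'⟩
        · rw [← Nat.add_assoc, h']
          refine ⟨ih.1, ?_⟩
          rw [ih.2, hz, ← evalWord_append, factor_append α (ht (by omega)) (ht (by omega))]
        · simp [ih] at h'
        · simp [h'] at hf
    have hf := Nat.find_spec hex
    obtain ⟨h₁, h₂⟩ := hinv (Nat.find hex) le_rfl
    generalize Nat.find hex = n at *
    rcases hs (i + n) with h' | ⟨h', -⟩ | ⟨e', h₁', h₂', h'⟩
    · simp [h'] at hf
    · simp [h₁] at h'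
    · obtain rfl : e = e' := by simpa [h₁] using h₁'
      refine ⟨⟨i + n + 1, by simp [h']⟩, ?_⟩
      rw [← h₂', h₂, hz, ← evalWord_append, factor_append α (ht (by omega)) (ht (by omega))]
  choose next hnext using hnext
  let i₀ : {i // (s i).1 = 1 ∧ (s i).2.1 = some e} := ⟨N + 1, by simp [hsN]⟩
  rw [prod_eq_mix h α (fun n => t (next^[n] i₀).1) x e hx]
  · exact hH
  · intro n
    simp only [Function.iterate_succ_apply']
    exact hnext _

/-- Ramsey's argument, with the pair `(i, j)` coloured by the value of the factor from `t i` to `t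
j`, yields the resets of the run. -/
theorem exists_valueStep [Finite M.F] {H : Set M.I} {z : ℕ → WithOne M.F}
    (h : A → M.F) (α : ℕ → A) {t : ℕ → ℕ} (ht : Monotone t) (ht0 : t 0 = 0)
    (htop : ∀ N, ∃ n, N ≤ t n)
    (hz : ∀ n, z n = evalWord M h (factor α (t n) (t (n + 1))))
    (hH : M.prod (fun n => h (α n)) ∈ H) :
    ∃ s : ℕ → ValueState M, s 0 = (1, none, false) ∧
      (∀ n, ValueStep H (s n) (z n) (s (n + 1))) ∧ ∀ N, ∃ n, N ≤ n ∧ (s n).2.2 = true := by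
  classical
  -- The path starts where the prefix is already non-empty, so that the value `x` of the stem lies
  -- in `M.F`.
  obtain ⟨n₀, hn₀⟩ := htop 1
  obtain ⟨c, f, hf, hf0, hc⟩ :=
    exists_strictMono_colour (fun i j => evalWord M h (factor α (t i) (t j))) n₀
  -- The colour `1` is impossible: all factors along the path would be empty, although `t` is
  -- unbounded.
  obtain ⟨e, rfl⟩ : ∃ e : M.F, c = e := by
    by_contra hne
    have hc1 : c = 1 := by
      cases c with
      | one => rfl
      | coe e => exact absurd ⟨e, rfl⟩ hne
    have hconst : ∀ n, t (f n) ≤ t (f 0) := by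
      intro n
      induction n with
      | zero => exact le_rfl
      | succ n ih =>
        have := hc n
        rw [hc1, evalWord_eq_one_iff, factor_eq_nil_iff] at this
        exact this.trans ih
    obtain ⟨n, hn⟩ := htop (t (f 0) + 1)
    have := ht (hf.le_apply (x := n))
    have := hconst n
    omega
  obtain ⟨x, hx⟩ : ∃ x : M.F, evalWord M h (factor α 0 (t (f 0))) = x := by
    have : 0 < t (f 0) := lt_of_lt_of_le hn₀ (ht hf0)
    refine ⟨blockProd (fun l => h (α l)) 0 (t (f 0) - 1), ?_⟩
    rw [← evalWord_factor, show 0 + (t (f 0) - 1) + 1 = t (f 0) by omega]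
  have hxH : M.mix x (M.prod fun _ => e) ∈ H := by
    rwa [← prod_eq_mix h α (fun n => t (f n)) x e hx hc]
  -- The run makes its guess at `f 0`, raises the flag at each `f (i + 1)`, and multiplies
  -- elsewhere.
  let s : ℕ → ValueState M := fun n => Nat.rec (1, none, false) (fun n q =>
    if n + 1 = f 0 then (1, some e, false)
    else if ∃ i, n + 1 = f (i + 1) then (1, some e, true) else (q.1 * z n, q.2.1, false)) n
  have hsucc : ∀ n, s (n + 1) = if n + 1 = f 0 then (1, some e, false)
    else if ∃ i, n + 1 = f (i + 1) then (1, some e, true) else ((s n).1 * z n, (s n).2.1, false) :=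
    fun n => rfl
  have hf0pos : 0 < f 0 := by
    rcases Nat.eq_zero_or_pos (f 0) with h0 | h0
    · have := ht hf0
      rw [h0, ht0] at this
      omega
    · exact h0
  have hbefore : ∀ n, n < f 0 → (s n).1 = evalWord M h (factor α 0 (t n)) ∧ (s n).2.1 = none := by
    intro n
    induction n with
    | zero => intro _; simp [s, ht0, factor_self, evalWord_nil]
    | succ n ih =>
      intro hn
      have hno : ¬ ∃ i, n + 1 = f (i + 1) := by
        rintro ⟨i, hi⟩
        have := hf (show 0 < i + 1 by omega)
        omega
      rw [hsucc, if_neg (by omega), if_neg hno]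
      refine ⟨?_, (ih (by omega)).2⟩
      rw [(ih (by omega)).1, hz, ← evalWord_append,
        factor_append α (Nat.zero_le _) (ht (by omega))]
  have hstart : ∀ i, (s (f i)).1 = 1 ∧ (s (f i)).2.1 = some e := by
    intro i
    have hfi : 0 < f i := hf0pos.trans_le (hf.monotone (Nat.zero_le i))
    obtain ⟨n, hn⟩ : ∃ n, f i = n + 1 := ⟨f i - 1, by omega⟩
    rw [hn, hsucc]
    by_cases h0 : n + 1 = f 0
    · simp [h0]
    · rw [if_neg h0, if_pos]
      · simp
      · cases i with
        | zero => exact absurd hn.symm h0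
        | succ i => exact ⟨i, hn.symm⟩
  have hmid : ∀ i k, f i + k < f (i + 1) →
      (s (f i + k)).1 = evalWord M h (factor α (t (f i)) (t (f i + k))) ∧
        (s (f i + k)).2.1 = some e := by
    intro i k
    induction k with
    | zero =>
      intro _
      refine ⟨?_, (hstart i).2⟩
      rw [Nat.add_zero, (hstart i).1, factor_self, evalWord_nil]
    | succ k ih =>
      intro hk
      have ih := ih (by omega)
      have hno : ∀ j, f i + k + 1 ≠ f j := by
        intro j hj
        have h₁ : i < j := hf.lt_iff_lt.1 (by omega)
        have h₂ : j < i + 1 := hf.lt_iff_lt.1 (by omega)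
        omega
      rw [← Nat.add_assoc, hsucc, if_neg (hno 0), if_neg (by simpa using fun i => hno (i + 1))]
      refine ⟨?_, ih.2⟩
      rw [ih.1, hz, ← evalWord_append, factor_append α (ht (by omega)) (ht (by omega))]
  refine ⟨s, rfl, fun n => ?_, fun N => ?_⟩
  · by_cases h0 : n + 1 = f 0
    · refine Or.inr (Or.inl ⟨(hbefore n (by omega)).2, x, e, ?_, hxH, ?_⟩)
      · rw [(hbefore n (by omega)).1, hz, ← evalWord_append,
          factor_append α (Nat.zero_le _) (ht (by omega)), h0, hx]
      · rw [hsucc, if_pos h0]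
    · by_cases hi : ∃ i, n + 1 = f (i + 1)
      · have hs := hsucc n
        rw [if_neg h0, if_pos hi] at hs
        obtain ⟨i, hi⟩ := hi
        have hlt := hf (show i < i + 1 by omega)
        have hm := hmid i (n - f i) (by omega)
        rw [show f i + (n - f i) = n by omega] at hm
        refine Or.inr (Or.inr ⟨e, hm.2, ?_, hs⟩)
        rw [hm.1, hz, ← evalWord_append, factor_append α (ht ?_) (ht (by omega)), hi, hc]
        omega
      · left
        rw [hsucc, if_neg h0, if_neg hi]
  · have hfN : 0 < f (N + 1) := hf0pos.trans_le (hf.monotone (Nat.zero_le _))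
    refine ⟨f (N + 1), (hf.le_apply (x := N)).trans (hf.monotone (Nat.le_succ N)), ?_⟩
    obtain ⟨n, hn⟩ : ∃ n, f (N + 1) = n + 1 := ⟨f (N + 1) - 1, by omega⟩
    have : n + 1 ≠ f 0 := by
      rw [← hn]
      exact fun h => absurd (hf.injective h) (by omega)
    rw [hn, hsucc, if_neg this, if_pos ⟨N, hn.symm⟩]

end Factors

/-! ### Directive sequences and growing prefixes -/

section Directing

variable {A : Type u} {M : OmegaSemigroup.{v, w}}

/-- The finite word `x` is a prefix of the infinite word `α`. -/
def IsPrefixOf (x : List A) (α : ℕ → A) : Prop := x = wordPrefix α x.length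

theorem length_wordPrefix (α : ℕ → A) (n : ℕ) : (wordPrefix α n).length = n := by
  simp [wordPrefix]

theorem wordPrefix_succ (α : ℕ → A) (n : ℕ) : wordPrefix α (n + 1) = wordPrefix α n ++ [α n] := by
  simp [wordPrefix, List.range_succ]

theorem isPrefixOf_wordPrefix (α : ℕ → A) (n : ℕ) : IsPrefixOf (wordPrefix α n) α := by
  simp [IsPrefixOf, length_wordPrefix]

theorem wordPrefix_append_factor (α : ℕ → A) {m n : ℕ} (hmn : m ≤ n) :
    wordPrefix α m ++ factor α m n = wordPrefix α n := by
  rw [wordPrefix_eq_factor, wordPrefix_eq_factor, factor_append α (Nat.zero_le _) hmn]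

theorem wordPrefix_isPrefix (α : ℕ → A) {m n : ℕ} (hmn : m ≤ n) :
    wordPrefix α m <+: wordPrefix α n :=
  ⟨_, wordPrefix_append_factor α hmn⟩

theorem IsPrefixOf.of_isPrefix {x y : List A} {α : ℕ → A} (hxy : x <+: y) (hy : IsPrefixOf y α) :
    IsPrefixOf x α := by
  have hx : x <+: wordPrefix α y.length := by rwa [← hy]
  have h₂ := wordPrefix_isPrefix α hxy.length_le
  exact (List.prefix_of_prefix_length_le hx h₂ (by rw [length_wordPrefix])).eq_of_length
    (by rw [length_wordPrefix])

theorem IsPrefixOf.eq_factor {x y : List A} {α : ℕ → A} (hxy : IsPrefixOf (x ++ y) α) :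
    y = factor α x.length (x ++ y).length := by
  have hx : IsPrefixOf x α := hxy.of_isPrefix (List.prefix_append x y)
  have h₁ : x ++ y = wordPrefix α (x ++ y).length := hxy
  have h₂ : x = wordPrefix α x.length := hx
  have h₃ := wordPrefix_append_factor α (m := x.length) (n := (x ++ y).length) (by simp)
  rw [← h₁, ← h₂] at h₃
  exact (List.append_cancel_left h₃).symm

/-- A growing sequence of finite words converges to an infinite word. -/
theorem exists_isPrefixOf (W : ℕ → List A) (hW : ∀ k, W k <+: W (k + 1))
    (hlen : ∀ N, ∃ k, N ≤ (W k).length) : ∃ α : ℕ → A, ∀ k, IsPrefixOf (W k) α := by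
  have hmono : ∀ j k, j ≤ k → W j <+: W k := fun j k hjk =>
    Nat.le_induction (List.prefix_refl _) (fun k _ ih => ih.trans (hW k)) k hjk
  choose K hK using fun i => hlen (i + 1)
  refine ⟨fun i => (W (K i))[i]'(hK i), fun k => ?_⟩
  apply List.ext_getElem
  · rw [length_wordPrefix]
  · intro i h₁ h₂
    simp only [wordPrefix, List.getElem_map, List.getElem_range]
    rcases le_total k (K i) with hk | hk
    · exact (hmono _ _ hk).getElem h₁
    · exact ((hmono _ _ hk).getElem (hK i)).symm

theorem Substitution.length_le_onWord (σ : Substitution A) (x : List A) :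
    x.length ≤ (σ.onWord x).length := by
  induction x with
  | nil => simp
  | cons a x ih =>
    have := List.length_pos_iff.2 (σ.img_ne_nil a)
    simp only [Substitution.onWord_cons, List.length_append, List.length_cons]
    omega

theorem Substitution.onWord_isPrefix (σ : Substitution A) {x y : List A} (hxy : x <+: y) :
    σ.onWord x <+: σ.onWord y := by
  obtain ⟨z, rfl⟩ := hxy
  exact ⟨σ.onWord z, (σ.onWord_append x z).symm⟩

/-- The word `σ_n(σ_{n+1}(⋯ σ_{n+k-1}(x)))`. -/
def lowerWord (s : ℕ → Substitution A) (n : ℕ) : ℕ → List A → List A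
  | 0, x => x
  | k + 1, x => lowerWord s n k ((s (n + k)).onWord x)

theorem lowerWord_succ' (s : ℕ → Substitution A) (n k : ℕ) (x : List A) :
    lowerWord s n (k + 1) x = (s n).onWord (lowerWord s (n + 1) k x) := by
  induction k generalizing x with
  | zero => rfl
  | succ k ih =>
    rw [lowerWord, ih, lowerWord, show n + 1 + k = n + (k + 1) by omega]

theorem lowerWord_append (s : ℕ → Substitution A) (n k : ℕ) (x y : List A) :
    lowerWord s n k (x ++ y) = lowerWord s n k x ++ lowerWord s n k y := by
  induction k generalizing x y with
  | zero => rfl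
  | succ k ih => simp only [lowerWord, Substitution.onWord_append, ih]

theorem length_le_lowerWord (s : ℕ → Substitution A) (n k : ℕ) (x : List A) :
    x.length ≤ (lowerWord s n k x).length := by
  induction k generalizing x with
  | zero => exact le_rfl
  | succ k ih => exact ((s (n + k)).length_le_onWord x).trans (ih _)

/-- The morphism `h ∘ σ_0 ∘ ⋯ ∘ σ_{n-1}`. -/
noncomputable def pullbackSeq (h : A → M.F) (s : ℕ → Substitution A) : ℕ → A → M.F
  | 0 => h
  | n + 1 => pullback (pullbackSeq h s n) (s n)

theorem evalWord_pullbackSeq (h : A → M.F) (s : ℕ → Substitution A) (n : ℕ) (x : List A) :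
    evalWord M (pullbackSeq h s n) x = evalWord M h (lowerWord s 0 n x) := by
  induction n generalizing x with
  | zero => rfl
  | succ n ih => rw [pullbackSeq, evalWord_pullback, ih, lowerWord, Nat.zero_add]

theorem unbounded_of_frequently_lt {t : ℕ → ℕ} (ht : Monotone t)
    (hlt : ∀ N, ∃ n, N ≤ n ∧ t n < t (n + 1)) (N : ℕ) : ∃ n, N ≤ t n := by
  induction N with
  | zero => exact ⟨0, Nat.zero_le _⟩
  | succ N ih =>
    obtain ⟨n, hn⟩ := ih
    obtain ⟨m, hm, hlt⟩ := hlt n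
    have := ht hm
    exact ⟨m + 1, by omega⟩

/-- A sequence of words `x n` such that `σ_n(x (n+1))` is `x n` followed by `r n` yields a word
that is directed by `σ`. -/
theorem exists_directs {s : ℕ → Substitution A} {x r : ℕ → List A}
    (hx : ∀ n, (s n).onWord (x (n + 1)) = x n ++ r n) (hr : ∀ N, ∃ n, N ≤ n ∧ r n ≠ []) :
    ∃ α, Directs s α ∧ ∀ k, IsPrefixOf (lowerWord s 0 k (x k)) α := by
  have hstep : ∀ n k, lowerWord s n (k + 1) (x (n + (k + 1))) =
      lowerWord s n k (x (n + k)) ++ lowerWord s n k (r (n + k)) := by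
    intro n k
    rw [lowerWord, ← Nat.add_assoc, hx, lowerWord_append]
  have hlen : ∀ n N, ∃ k, N ≤ (lowerWord s n k (x (n + k))).length := by
    intro n
    apply unbounded_of_frequently_lt
    · refine monotone_nat_of_le_succ fun k => ?_
      rw [hstep, List.length_append]
      omega
    · intro N
      obtain ⟨m, hm, hne⟩ := hr (n + N)
      refine ⟨m - n, by omega, ?_⟩
      rw [hstep, List.length_append]
      have := length_le_lowerWord s n (m - n) (r (n + (m - n)))
      have h' := List.length_pos_iff.2 hne
      rw [show n + (m - n) = m by omega] at this ⊢
      omega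
  -- The images at level `n` of the words `x (n + k)` form a growing sequence with limit `β n`.
  -- Applying `s n` to the sequence of level `n + 1` gives that of level `n`, shifted by one.
  choose β hβ using fun n => exists_isPrefixOf (fun k => lowerWord s n k (x (n + k)))
    (fun k => ⟨_, (hstep n k).symm⟩) (hlen n)
  refine ⟨β 0, ⟨β, rfl, fun n i => ?_⟩, fun k => by simpa using hβ 0 k⟩
  obtain ⟨k, hk⟩ := hlen (n + 1) i
  have h₁ : wordPrefix (β (n + 1)) i <+: lowerWord s (n + 1) k (x (n + 1 + k)) := by
    have := hβ (n + 1) k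
    rw [IsPrefixOf] at this
    rw [this]
    exact wordPrefix_isPrefix _ hk
  have h₂ := (s n).onWord_isPrefix h₁
  rw [← lowerWord_succ', show n + 1 + k = n + (k + 1) by omega] at h₂
  exact IsPrefixOf.of_isPrefix h₂ (hβ n (k + 1))

/-! ### The states that follow a directed word -/

/-- The states that follow a directed word `α`, at the level `n`: the morphism on the words of that
level, a set that contains the letters of a prefix on which all further substitutions of the
sequence act letter by letter, and the letter, if any, that generates the rest of the word. -/
abbrev FollowState (A : Type u) (M : OmegaSemigroup.{v, w}) := (A → M.F) × Set A × Option A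

/-- The transitions between the levels, where `z` is the value by which the known prefix grows. -/
def FollowStep (σ : Substitution A) (d : FollowState A M) (z : WithOne M.F)
    (d' : FollowState A M) : Prop :=
  d'.1 = pullback d.1 σ ∧ (∀ b ∈ d.2.1, ∃ c ∈ d'.2.1, HeadTail σ d.1 c b 1) ∧
    ((d.2.2 = none ∧ d'.2.2 = none ∧ (z = 1 ∨ ∃ c ∈ d'.2.1, z = d'.1 c)) ∨
      (d.2.2 = none ∧ ∃ c, d'.2.2 = some c ∧ z = d'.1 c) ∨
      ∃ b c, d.2.2 = some b ∧ d'.2.2 = some c ∧ HeadTail σ d.1 c b z)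

/-- This is why the automaton can read classes instead of substitutions. -/
theorem FollowStep.congr {σ μ : Substitution A} (hσ : Xi.mk M σ = Xi.mk M μ)
    {d d' : FollowState A M} {z : WithOne M.F} (hd : FollowStep σ d z d') :
    FollowStep μ d z d' := by
  obtain ⟨h₁, h₂, h₃⟩ := hd
  refine ⟨by rw [h₁, pullback_congr hσ], fun b hb => ?_, ?_⟩
  · obtain ⟨c, hc, hcb⟩ := h₂ b hb
    exact ⟨c, hc, hcb.congr hσ⟩
  · rcases h₃ with h | h | ⟨b, c, hb, hc, h⟩
    · exact Or.inl h
    · exact Or.inr (Or.inl h)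
    · exact Or.inr (Or.inr ⟨b, c, hb, hc, h.congr hσ⟩)

theorem onWord_map_of_img_eq {σ : Substitution A} {f : A → A} {w : List A}
    (hf : ∀ b ∈ w, σ.img (f b) = [b]) : σ.onWord (w.map f) = w := by
  induction w with
  | nil => rfl
  | cons b w ih =>
    rw [List.map_cons, Substitution.onWord_cons, hf b (by simp), ih fun c hc => hf c (by simp [hc])]
    rfl

/-- The map `f` and the appended word `v` are chosen before `w`: one choice lifts all words over the
set, so the stable prefix itself need not be remembered. -/
theorem FollowStep.exists_lift {σ : Substitution A} {d d' : FollowState A M} {z : WithOne M.F}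
    (hd : FollowStep σ d z d') :
    ∃ (f : A → A) (v : List A), (∀ b ∈ d.2.1, f b ∈ d'.2.1) ∧ (∀ c ∈ v, c ∈ d'.2.1) ∧
      ∀ w : List A, (∀ b ∈ w, b ∈ d.2.1) → ∃ r, z = evalWord M d.1 r ∧
        σ.onWord (w.map f ++ v ++ d'.2.2.toList) = w ++ d.2.2.toList ++ r := by
  classical
  obtain ⟨h₁, h₂, h₃⟩ := hd
  simp only [headTail_one_iff] at h₂
  have hf : ∃ f : A → A, ∀ b ∈ d.2.1, f b ∈ d'.2.1 ∧ σ.img (f b) = [b] := by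
    refine ⟨fun b => if hb : b ∈ d.2.1 then (h₂ b hb).choose else b, fun b hb => ?_⟩
    simp only [hb, dite_true]
    exact (h₂ b hb).choose_spec
  obtain ⟨f, hf⟩ := hf
  have hw : ∀ w : List A, (∀ b ∈ w, b ∈ d.2.1) → σ.onWord (w.map f) = w := fun w hw =>
    onWord_map_of_img_eq fun b hb => (hf b (hw b hb)).2
  have hsingle : ∀ c, σ.onWord [c] = σ.img c := fun c => by simp [Substitution.onWord]
  refine ⟨f, ?_⟩
  -- The cases: no growth; a new stable letter; the generating letter appears; the generating letter
  -- is replaced by one whose image begins with it.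
  rcases h₃ with ⟨ha, ha', rfl | ⟨y, hy, rfl⟩⟩ | ⟨ha, c, ha', rfl⟩ | ⟨b, c, ha, ha', x, hx, rfl⟩
  · refine ⟨[], fun b hb => (hf b hb).1, by simp, fun w hwd => ⟨[], rfl, ?_⟩⟩
    simp [ha, ha', hw w hwd]
  · refine ⟨[y], fun b hb => (hf b hb).1, by simpa using hy, fun w hwd => ⟨σ.img y, ?_, ?_⟩⟩
    · rw [h₁, coe_pullback]
    · simp [ha, ha', Substitution.onWord_append, hw w hwd, hsingle]
  · refine ⟨[], fun b hb => (hf b hb).1, by simp, fun w hwd => ⟨σ.img c, ?_, ?_⟩⟩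
    · rw [h₁, coe_pullback]
    · simp [ha, ha', Substitution.onWord_append, hw w hwd, hsingle]
  · refine ⟨[], fun b hb => (hf b hb).1, by simp, fun w hwd => ⟨x, rfl, ?_⟩⟩
    simp [ha, ha', Substitution.onWord_append, hw w hwd, hsingle, hx]

/-- The word of a level is a word over the remembered set, lifted from level to level, followed by
the generating letter if there is one. -/
theorem exists_words_of_followStep {s : ℕ → Substitution A} {d : ℕ → FollowState A M}
    {z : ℕ → WithOne M.F} (hd0 : (d 0).2.2 = none)
    (hd : ∀ n, FollowStep (s n) (d n) (z n) (d (n + 1))) :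
    ∃ x r : ℕ → List A, x 0 = [] ∧ (∀ n, (s n).onWord (x (n + 1)) = x n ++ r n) ∧
      ∀ n, z n = evalWord M (d n).1 (r n) := by
  choose f v hf hv hr using fun n => (hd n).exists_lift
  let w : ℕ → List A := fun n => Nat.rec [] (fun n w => w.map (f n) ++ v n) n
  have hw : ∀ n, ∀ b ∈ w n, b ∈ (d n).2.1 := by
    intro n
    induction n with
    | zero => simp [w]
    | succ n ih =>
      intro b hb
      have hb : b ∈ (w n).map (f n) ++ v n := hb
      rw [List.mem_append, List.mem_map] at hb
      rcases hb with ⟨c, hc, rfl⟩ | hb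
      · exact hf n c (ih c hc)
      · exact hv n b hb
  choose r hz hr using fun n => hr n (w n) (hw n)
  exact ⟨fun n => w n ++ (d n).2.2.toList, r, by simp [w, hd0], hr, hz⟩

theorem followStep_fst {s : ℕ → Substitution A} {d : ℕ → FollowState A M}
    {z : ℕ → WithOne M.F} (hd : ∀ n, FollowStep (s n) (d n) (z n) (d (n + 1))) (n : ℕ) :
    (d n).1 = pullbackSeq (d 0).1 s n := by
  induction n with
  | zero => rfl
  | succ n ih => rw [(hd n).1, ih, pullbackSeq]

/-- Acceptance makes `r n` non-empty infinitely often, so the words converge. The value `z n` is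
that of the factor of `α` obtained by carrying `r n` down to level `0`, so the value check applies
to `α`. -/
theorem exists_directs_of_steps {H : Set M.I} {h : A → M.F} {s : ℕ → Substitution A}
    {d : ℕ → FollowState A M} {c : ℕ → ValueState M} {z : ℕ → WithOne M.F}
    (hd0 : d 0 = (h, ∅, none)) (hc0 : c 0 = (1, none, false))
    (hd : ∀ n, FollowStep (s n) (d n) (z n) (d (n + 1)))
    (hc : ∀ n, ValueStep H (c n) (z n) (c (n + 1)))
    (hacc : ∀ N, ∃ n, N ≤ n ∧ (c n).2.2 = true) :
    ∃ α, M.prod (fun n => h (α n)) ∈ H ∧ Directs s α := by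
  obtain ⟨x, r, hx0, hx, hz⟩ := exists_words_of_followStep (by rw [hd0]) hd
  have hr : ∀ N, ∃ n, N ≤ n ∧ r n ≠ [] := by
    intro N
    obtain ⟨n, hn, hne⟩ := exists_ne_one_of_valueStep hc hacc N
    refine ⟨n, hn, fun h0 => hne ?_⟩
    rw [hz, h0, evalWord_nil]
  obtain ⟨α, hα, hpre⟩ := exists_directs hx hr
  refine ⟨α, ?_, hα⟩
  have hstep : ∀ k, lowerWord s 0 (k + 1) (x (k + 1)) =
      lowerWord s 0 k (x k) ++ lowerWord s 0 k (r k) := by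
    intro k
    rw [lowerWord, Nat.zero_add, hx, lowerWord_append]
  refine prod_mem_of_valueStep h α (t := fun k => (lowerWord s 0 k (x k)).length)
    (monotone_nat_of_le_succ fun k => ?_) (by simp [hx0, lowerWord]) (fun k => ?_) hc0 hc hacc
  · rw [hstep, List.length_append]
    omega
  · have := hpre (k + 1)
    rw [hstep] at this
    simp only [hstep]
    rw [← this.eq_factor, hz, followStep_fst hd, hd0, evalWord_pullbackSeq]

/-! ### Following a directed word -/

/-- From the level `N` on, the substitutions act letter by letter on the prefix of length `i`. -/
def StablePrefix (s : ℕ → Substitution A) (β : ℕ → ℕ → A) (i N : ℕ) : Prop :=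
  ∀ n, N ≤ n → ((s n).onWord (wordPrefix (β (n + 1)) i)).length = i

open Classical in
/-- A slowly growing length of prefixes on which all further substitutions act letter by letter. -/
noncomputable def stableLength (s : ℕ → Substitution A) (β : ℕ → ℕ → A) : ℕ → ℕ
  | 0 => 0
  | n + 1 => if StablePrefix s β (stableLength s β n + 1) (n + 1) then stableLength s β n + 1
    else stableLength s β n

theorem stablePrefix_stableLength (s : ℕ → Substitution A) (β : ℕ → ℕ → A) (n : ℕ) :
    StablePrefix s β (stableLength s β n) n := by
  induction n with
  | zero => intro n _; simp [stableLength, wordPrefix, Substitution.onWord]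
  | succ n ih =>
    rw [stableLength]
    split_ifs with hs
    · exact hs
    · exact fun m hm => ih m (by omega)

theorem stableLength_succ_cases (s : ℕ → Substitution A) (β : ℕ → ℕ → A) (n : ℕ) :
    stableLength s β (n + 1) = stableLength s β n ∨
      stableLength s β (n + 1) = stableLength s β n + 1 := by
  rw [stableLength]
  split_ifs <;> simp

theorem stableLength_mono (s : ℕ → Substitution A) (β : ℕ → ℕ → A) :
    Monotone (stableLength s β) :=
  monotone_nat_of_le_succ fun n => by rcases stableLength_succ_cases s β n with h | h <;> omega

/-- A bounded monotone sequence settles at some `j`. Were the length `j + 1` stable from a level `n`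
on, the recursion would have increased the length right after `max n N`. -/
theorem stableLength_unbounded_or (s : ℕ → Substitution A) (β : ℕ → ℕ → A) :
    (∀ N, ∃ n, N ≤ stableLength s β n) ∨
      ∃ j N, (∀ n, N ≤ n → stableLength s β n = j) ∧ ∀ n, ¬ StablePrefix s β (j + 1) n := by
  rw [or_iff_not_imp_left]
  intro hb
  push Not at hb
  obtain ⟨B, hB⟩ := hb
  have hconst : ∃ N, ∀ n, N ≤ n → stableLength s β n = stableLength s β N := by
    by_contra hno
    push Not at hno
    obtain ⟨n, hn⟩ := unbounded_of_frequently_lt (stableLength_mono s β) (fun N => by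
      obtain ⟨n, hn, hne⟩ := hno N
      have hlt := lt_of_le_of_ne (stableLength_mono s β hn) hne.symm
      by_contra hall
      push Not at hall
      have : ∀ k, stableLength s β (N + k) ≤ stableLength s β N := fun k => by
        induction k with
        | zero => exact le_rfl
        | succ k ih => exact (hall (N + k) (by omega)).trans ih
      have := this (n - N)
      rw [show N + (n - N) = n by omega] at this
      omega) B
    exact absurd (hB n) (by omega)
  obtain ⟨N, hN⟩ := hconst
  refine ⟨stableLength s β N, N, hN, fun n hn => ?_⟩
  have h₁ := hN (max n N) (le_max_right _ _)
  have h₂ := hN (max n N + 1) (by omega)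
  rw [stableLength, h₁, if_pos] at h₂
  · omega
  · exact fun m hm => hn m (by omega)

/-- If the first `i` letters have an image of length `i`, the image of the next letter starts
exactly at position `i`. -/
theorem MapsTo_letter {σ : Substitution A} {β γ : ℕ → A} (hσ : σ.MapsTo β γ) {i : ℕ}
    (hi : (σ.onWord (wordPrefix β i)).length = i) :
    σ.onWord (wordPrefix β i) = wordPrefix γ i ∧ ∃ x, σ.img (β i) = γ i :: x := by
  have h₀ := hσ i
  rw [hi] at h₀
  refine ⟨h₀, ?_⟩
  have h₁ := hσ (i + 1)
  rw [wordPrefix_succ, Substitution.onWord_append, h₀] at h₁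
  have h₂ : σ.onWord [β i] = σ.img (β i) := by simp [Substitution.onWord]
  obtain ⟨c, x, hx⟩ := List.exists_cons_of_ne_nil (σ.img_ne_nil (β i))
  rw [h₂, hx] at h₁
  have h₃ := congrArg (fun l => l[i]?) h₁
  simp only [List.length_append, length_wordPrefix, List.length_cons] at h₃
  rw [List.getElem?_append_right (by rw [length_wordPrefix]), length_wordPrefix] at h₃
  simp only [Nat.sub_self, List.getElem?_cons_zero, wordPrefix, List.getElem?_map] at h₃
  rw [List.getElem?_range (by omega)] at h₃
  simp only [Option.map_some, Option.some.injEq] at h₃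
  exact ⟨x, by rw [hx, h₃]⟩

/-- Images have length at least one, so equality for `j` letters leaves no excess on any shorter
prefix. -/
theorem length_onWord_of_le {σ : Substitution A} {β : ℕ → A} {i j : ℕ} (hij : i ≤ j)
    (hj : (σ.onWord (wordPrefix β j)).length = j) : (σ.onWord (wordPrefix β i)).length = i := by
  have h₁ := σ.length_le_onWord (wordPrefix β i)
  have h₂ := σ.length_le_onWord (factor β i j)
  rw [← wordPrefix_append_factor β hij, Substitution.onWord_append, List.length_append] at hj
  rw [length_factor] at h₂
  rw [length_wordPrefix] at h₁
  omega

theorem MapsTo_img_eq {σ : Substitution A} {β γ : ℕ → A} (hσ : σ.MapsTo β γ) {i j : ℕ} (hij : i < j)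
    (hj : (σ.onWord (wordPrefix β j)).length = j) : σ.img (β i) = [γ i] := by
  have hi := length_onWord_of_le (Nat.le_of_lt hij) hj
  have hi' := length_onWord_of_le (Nat.succ_le_of_lt hij) hj
  obtain ⟨h₁, x, hx⟩ := MapsTo_letter hσ hi
  rw [Nat.succ_eq_add_one, wordPrefix_succ, Substitution.onWord_append, List.length_append,
    hi] at hi'
  have h₂ : σ.onWord [β i] = σ.img (β i) := by simp [Substitution.onWord]
  rw [h₂, hx, List.length_cons] at hi'
  rw [hx, List.length_eq_zero_iff.1 (by omega : x.length = 0)]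

theorem isPrefixOf_lowerWord {s : ℕ → Substitution A} {β : ℕ → ℕ → A}
    (hβ : ∀ n, (s n).MapsTo (β (n + 1)) (β n)) (n : ℕ) {x : List A} (hx : IsPrefixOf x (β n)) :
    IsPrefixOf (lowerWord s 0 n x) (β 0) := by
  induction n generalizing x with
  | zero => exact hx
  | succ n ih =>
    rw [lowerWord, Nat.zero_add]
    apply ih
    rw [IsPrefixOf] at hx
    rw [hx]
    exact hβ n _

/-- The steps follow the stable prefix, whose letters form `D n`. If its length settles, the next
letter becomes the generating letter. -/
theorem exists_followStep {h : A → M.F} {s : ℕ → Substitution A} {β : ℕ → ℕ → A}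
    (hβ : ∀ n, (s n).MapsTo (β (n + 1)) (β n)) :
    ∃ (d : ℕ → FollowState A M) (x r : ℕ → List A), d 0 = (h, ∅, none) ∧ x 0 = [] ∧
      (∀ n, IsPrefixOf (x n) (β n)) ∧ (∀ n, (s n).onWord (x (n + 1)) = x n ++ r n) ∧
      (∀ n, FollowStep (s n) (d n) (evalWord M (pullbackSeq h s n) (r n)) (d (n + 1))) ∧
      ∀ N, ∃ n, N ≤ n ∧ r n ≠ [] := by
  have hst := stablePrefix_stableLength s β
  set l := stableLength s β with hl
  have hl0 : l 0 = 0 := rfl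
  have hsucc := stableLength_succ_cases s β
  rw [← hl] at hsucc
  let D : ℕ → Set A := fun n => {a | ∃ i < l n, β n i = a}
  have hD0 : D 0 = ∅ := by simp [D, hl0]
  have hDlift : ∀ n, ∀ b ∈ D n, ∃ c ∈ D (n + 1), HeadTail (s n) (pullbackSeq h s n) c b 1 := by
    rintro n b ⟨i, hi, rfl⟩
    have : l n ≤ l (n + 1) := by rcases hsucc n with h | h <;> omega
    exact ⟨β (n + 1) i, ⟨i, by omega, rfl⟩,
      headTail_one_iff.2 (MapsTo_img_eq (hβ n) hi (hst n n le_rfl))⟩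
  have hsingle : ∀ n c, (s n).onWord [c] = (s n).img c := fun n c => by simp [Substitution.onWord]
  -- `v n` is the letter, if any, by which the stable prefix grows between the levels `n` and `n +
  -- 1`.
  have hgrow : ∀ n, ∃ v, (v = [] ∨ ∃ c ∈ D (n + 1), v = [c]) ∧
      wordPrefix (β (n + 1)) (l (n + 1)) = wordPrefix (β (n + 1)) (l n) ++ v ∧
      (l n < l (n + 1) → v ≠ []) := by
    intro n
    rcases hsucc n with h | h
    · exact ⟨[], Or.inl rfl, by simp [h], by omega⟩
    · refine ⟨[β (n + 1) (l n)], Or.inr ⟨_, ⟨l n, by omega, rfl⟩, rfl⟩, ?_, by simp⟩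
      rw [h, wordPrefix_succ]
  choose v hv hvx hvne using hgrow
  have hvval : ∀ n, evalWord M (pullbackSeq h s n) ((s n).onWord (v n)) = 1 ∨
      ∃ c ∈ D (n + 1), evalWord M (pullbackSeq h s n) ((s n).onWord (v n)) =
        (pullbackSeq h s (n + 1) c : M.F) := by
    intro n
    rcases hv n with h0 | ⟨c, hc, h0⟩
    · left
      rw [h0]
      rfl
    · right
      refine ⟨c, hc, ?_⟩
      rw [h0, hsingle, pullbackSeq, coe_pullback]
  rcases stableLength_unbounded_or s β with htop | ⟨j, N, hj, hunst⟩
  · refine ⟨fun n => (pullbackSeq h s n, D n, none), fun n => wordPrefix (β n) (l n),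
      fun n => (s n).onWord (v n), by simp [hD0, pullbackSeq], by simp [hl0, wordPrefix],
      fun n => isPrefixOf_wordPrefix _ _, fun n => ?_, fun n => ⟨rfl, hDlift n, ?_⟩, fun N => ?_⟩
    · dsimp only
      rw [hvx, Substitution.onWord_append, (MapsTo_letter (hβ n) (hst n n le_rfl)).1]
    · exact Or.inl ⟨rfl, rfl, hvval n⟩
    -- If nothing were added from `N` on, the stable length could not exceed `l N`.
    · by_contra hno
      push Not at hno
      have hconst : ∀ k, l (N + k) ≤ l N := fun k => by
        induction k with
        | zero => exact le_rfl
        | succ k ih =>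
          by_contra hlt
          have hne := hvne (N + k) (by rw [← Nat.add_assoc] at hlt; omega)
          have h0 := (s (N + k)).length_le_onWord (v (N + k))
          rw [hno (N + k) (by omega), List.length_nil, Nat.le_zero, List.length_eq_zero_iff] at h0
          exact hne h0
      obtain ⟨n, hn⟩ := htop (l N + 1)
      have h₁ := stableLength_mono s β (show n ≤ N + n by omega)
      rw [← hl] at h₁ hn
      have h₂ := hconst n
      omega
  · have hjl : ∀ n, N ≤ n → l n = j := hj
    have hex : ∀ n, N ≤ n → ∃ x, (s n).img (β (n + 1) j) = β n j :: x := fun n hn =>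
      (MapsTo_letter (hβ n) (by have := hst n n le_rfl; rwa [hjl n hn] at this)).2
    have hpre : ∀ n, N ≤ n → (s n).onWord (wordPrefix (β (n + 1)) j) = wordPrefix (β n) j :=
      fun n hn => (MapsTo_letter (hβ n) (by have := hst n n le_rfl; rwa [hjl n hn] at this)).1
    -- Below `N` only the stable prefix grows. At `N` the generating letter is adjoined and its
    -- whole image is new. Later the image begins with the previous generating letter and only its
    -- tail is new.
    let r : ℕ → List A := fun n => if n < N then (s n).onWord (v n)
      else if n = N then (s n).img (β (n + 1) j) else ((s n).img (β (n + 1) j)).tail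
    refine ⟨fun n => (pullbackSeq h s n, D n, if n ≤ N then none else some (β n j)),
      fun n => if n ≤ N then wordPrefix (β n) (l n) else wordPrefix (β n) (j + 1), r,
      by simp [hD0, pullbackSeq], by simp [hl0, wordPrefix], fun n => ?_, fun n => ?_,
      fun n => ⟨rfl, hDlift n, ?_⟩, fun n₀ => ?_⟩
    · dsimp only
      split_ifs <;> exact isPrefixOf_wordPrefix _ _
    · rcases lt_trichotomy n N with hn | hn | hn
      · simp only [r, if_pos hn, if_pos (show n + 1 ≤ N by omega), if_pos (show n ≤ N by omega)]
        rw [hvx, Substitution.onWord_append, (MapsTo_letter (hβ n) (hst n n le_rfl)).1]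
      · simp only [r, if_neg (show ¬ n < N by omega), if_pos hn, if_neg (show ¬ n + 1 ≤ N by omega),
          if_pos (show n ≤ N by omega)]
        rw [wordPrefix_succ, Substitution.onWord_append, hsingle, hpre n (by omega),
          hjl n (by omega)]
      · simp only [r, if_neg (show ¬ n < N by omega), if_neg (show ¬ n = N by omega),
          if_neg (show ¬ n + 1 ≤ N by omega), if_neg (show ¬ n ≤ N by omega)]
        obtain ⟨x, hx⟩ := hex n (by omega)
        rw [wordPrefix_succ, Substitution.onWord_append, hsingle, hpre n (by omega), hx,
          wordPrefix_succ]
        simp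
    · rcases lt_trichotomy n N with hn | hn | hn
      · simp only [r, if_pos hn, if_pos (show n + 1 ≤ N by omega), if_pos (show n ≤ N by omega)]
        exact Or.inl ⟨trivial, trivial, hvval n⟩
      · simp only [r, if_neg (show ¬ n < N by omega), if_pos hn, if_neg (show ¬ n + 1 ≤ N by omega),
          if_pos (show n ≤ N by omega)]
        refine Or.inr (Or.inl ⟨trivial, _, rfl, ?_⟩)
        rw [pullbackSeq, coe_pullback]
      · simp only [r, if_neg (show ¬ n < N by omega), if_neg (show ¬ n = N by omega),
          if_neg (show ¬ n + 1 ≤ N by omega), if_neg (show ¬ n ≤ N by omega)]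
        obtain ⟨x, hx⟩ := hex n (by omega)
        exact Or.inr (Or.inr ⟨_, _, rfl, rfl, x, hx, by rw [hx, List.tail_cons]⟩)
    -- At arbitrarily late levels the prefix of length `j + 1` is not mapped letter by letter. The
    -- first `j` letters are, so there the tail is non-empty.
    · have := hunst (max n₀ (N + 1))
      rw [StablePrefix] at this
      push Not at this
      obtain ⟨n, hn, hne⟩ := this
      refine ⟨n, by omega, fun h0 => hne ?_⟩
      simp only [r, if_neg (show ¬ n < N by omega), if_neg (show ¬ n = N by omega)] at h0
      obtain ⟨x, hx⟩ := hex n (by omega)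
      rw [hx, List.tail_cons] at h0
      rw [wordPrefix_succ, Substitution.onWord_append, hsingle, hpre n (by omega), hx, h0]
      simp [length_wordPrefix]

/-- The sequence `s` directs a word with value in `H` if and only if there is an infinite accepting
sequence of steps. -/
theorem exists_directs_iff [Finite M.F] (H : Set M.I) (h : A → M.F) (s : ℕ → Substitution A) :
    (∃ α, M.prod (fun n => h (α n)) ∈ H ∧ Directs s α) ↔
      ∃ (d : ℕ → FollowState A M) (c : ℕ → ValueState M), d 0 = (h, ∅, none) ∧
        c 0 = (1, none, false) ∧
        (∀ n, ∃ z, FollowStep (s n) (d n) z (d (n + 1)) ∧ ValueStep H (c n) z (c (n + 1))) ∧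
        ∀ N, ∃ n, N ≤ n ∧ (c n).2.2 = true := by
  constructor
  · rintro ⟨α, hH, β, rfl, hβ⟩
    obtain ⟨d, x, r, hd0, hx0, hpre, hx, hd, hr⟩ := exists_followStep (h := h) hβ
    have hstep : ∀ k, lowerWord s 0 (k + 1) (x (k + 1)) =
        lowerWord s 0 k (x k) ++ lowerWord s 0 k (r k) := by
      intro k
      rw [lowerWord, Nat.zero_add, hx, lowerWord_append]
    have ht : Monotone fun k => (lowerWord s 0 k (x k)).length :=
      monotone_nat_of_le_succ fun k => by rw [hstep, List.length_append]; omega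
    obtain ⟨c, hc0, hc, hacc⟩ := exists_valueStep (H := H)
      (z := fun n => evalWord M (pullbackSeq h s n) (r n)) h (β 0) ht
      (by simp [hx0, lowerWord])
      (unbounded_of_frequently_lt ht fun N => by
        obtain ⟨n, hn, hne⟩ := hr N
        refine ⟨n, hn, ?_⟩
        have h₁ := length_le_lowerWord s 0 n (r n)
        have h₂ := List.length_pos_iff.2 hne
        rw [hstep, List.length_append]
        omega)
      (fun n => by
        have := isPrefixOf_lowerWord hβ (n + 1) (hpre (n + 1))
        rw [hstep] at this
        simp only [hstep]
        rw [← this.eq_factor, evalWord_pullbackSeq]) hH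
    exact ⟨d, c, hd0, hc0, fun n => ⟨_, hd n, hc n⟩, hacc⟩
  · rintro ⟨d, c, hd0, hc0, hdc, hacc⟩
    choose z hd hc using hdc
    exact exists_directs_of_steps hd0 hc0 hd hc hacc

end Directing

/-! ### The ω-semigroup of a Büchi automaton -/

section Runs

variable {Q : Type u}

/-- Sets of triples `(p, b, q)` of a source, a mark and a target. -/
def RunSet (Q : Type u) : Type u := Set (Q × Bool × Q)

instance : Semigroup (RunSet Q) where
  mul x y := {t | ∃ q b b', (t.1, b, q) ∈ (show Set _ from x) ∧
    (q, b', t.2.2) ∈ (show Set _ from y) ∧ t.2.1 = (b || b')}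
  mul_assoc x y z := by
    apply Set.ext
    rintro ⟨p, c, p'⟩
    constructor
    · rintro ⟨q, b, b', ⟨q', d, d', h₁, h₂, h₃⟩, h₄, h₅⟩
      dsimp only at h₁ h₂ h₃ h₄ h₅
      subst h₃ h₅
      exact ⟨q', d, d' || b', h₁, ⟨q, d', b', h₂, h₄, rfl⟩, by simp [Bool.or_assoc]⟩
    · rintro ⟨q, b, b', h₁, ⟨q', d, d', h₂, h₃, h₄⟩, h₅⟩
      dsimp only at h₁ h₂ h₃ h₄ h₅
      subst h₄ h₅
      exact ⟨q', b || d, d', ⟨q, b, d, h₁, h₂, rfl⟩, h₃, by simp [Bool.or_assoc]⟩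

/-- Membership in a set of triples. -/
def RunSet.Mem (x : RunSet Q) (p : Q) (b : Bool) (q : Q) : Prop := (p, b, q) ∈ (show Set _ from x)

theorem RunSet.mem_mul {x y : RunSet Q} {p q : Q} {b : Bool} :
    (x * y).Mem p b q ↔ ∃ r c c', x.Mem p c r ∧ y.Mem r c' q ∧ b = (c || c') := Iff.rfl

theorem RunSet.ext {x y : RunSet Q} (hxy : ∀ p b q, x.Mem p b q ↔ y.Mem p b q) : x = y :=
  Set.ext fun ⟨p, b, q⟩ => hxy p b q

/-- A triple of the product is a path with the disjunction of its marks. The path and marks are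
total functions, arbitrary outside the block, so that paths can be cut and glued without reindexing.
-/
theorem RunSet.mem_blockProd {x : ℕ → RunSet Q} {i n : ℕ} {p q : Q} {b : Bool} :
    (blockProd x i n).Mem p b q ↔ ∃ (r : ℕ → Q) (c : ℕ → Bool), r i = p ∧ r (i + n + 1) = q ∧
      (∀ l, i ≤ l → l ≤ i + n → (x l).Mem (r l) (c l) (r (l + 1))) ∧
      (b = true ↔ ∃ l, i ≤ l ∧ l ≤ i + n ∧ c l = true) := by
  induction n generalizing q b with
  | zero =>
    constructor
    · intro h
      refine ⟨fun l => if l ≤ i then p else q, fun _ => b, by simp, by simp, fun l h₁ h₂ => ?_, ?_⟩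
      · obtain rfl : l = i := by omega
        simpa [blockProd] using h
      · exact ⟨fun hb => ⟨i, le_rfl, le_rfl, hb⟩, fun ⟨_, _, _, hb⟩ => hb⟩
    · rintro ⟨r, c, rfl, rfl, h, hb⟩
      have hc : b = c i := by
        rw [Bool.eq_iff_iff, hb]
        constructor
        · rintro ⟨l, h₁, h₂, h₃⟩
          obtain rfl : l = i := by omega
          exact h₃
        · exact fun h => ⟨i, le_rfl, le_rfl, h⟩
      rw [hc]
      exact h i le_rfl le_rfl
  | succ n ih =>
    rw [blockProd, RunSet.mem_mul]
    constructor
    · rintro ⟨s, d, d', h₁, h₂, rfl⟩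
      obtain ⟨r, c, rfl, rfl, h, hd⟩ := ih.1 h₁
      refine ⟨fun l => if l ≤ i + n + 1 then r l else q,
        fun l => if l ≤ i + n then c l else d', if_pos (by omega), if_neg (by omega),
        fun l hl hl' => ?_, ?_⟩
      · dsimp only
        rcases Nat.lt_or_ge (i + n) l with hlt | hle
        · obtain rfl : l = i + n + 1 := by omega
          rw [if_pos le_rfl, if_neg (by omega), if_neg (by omega)]
          exact h₂
        · rw [if_pos (by omega), if_pos hle, if_pos (by omega)]
          exact h l hl hle
      · rw [Bool.or_eq_true, hd]
        constructor
        · rintro (⟨l, hl, hl', hc⟩ | hd')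
          · exact ⟨l, hl, by omega, by simpa only [if_pos hl'] using hc⟩
          · exact ⟨i + n + 1, by omega, by omega, by simpa using hd'⟩
        · rintro ⟨l, hl, hl', hc⟩
          dsimp only at hc
          split_ifs at hc with hle
          · exact Or.inl ⟨l, hl, hle, hc⟩
          · exact Or.inr hc
    · rintro ⟨r, c, rfl, rfl, h, hb⟩
      classical
      refine ⟨r (i + n + 1), decide (∃ l, i ≤ l ∧ l ≤ i + n ∧ c l = true), c (i + n + 1),
        ih.2 ⟨r, c, rfl, rfl, fun l h₁ h₂ => h l h₁ (by omega), by simp⟩,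
        h (i + n + 1) (by omega) (by omega), ?_⟩
      rw [Bool.eq_iff_iff, hb, Bool.or_eq_true, decide_eq_true_eq]
      constructor
      · rintro ⟨l, hl, hl', hc⟩
        rcases Nat.lt_or_ge (i + n) l with hlt | hle
        · obtain rfl : l = i + n + 1 := by omega
          exact Or.inr hc
        · exact Or.inl ⟨l, hl, hle, hc⟩
      · rintro (⟨l, hl, hl', hc⟩ | hc)
        · exact ⟨l, hl, by omega, hc⟩
        · exact ⟨i + n + 1, by omega, by omega, hc⟩

/-- The states from which there is an infinite run with infinitely many marks. -/
def RunSet.omegaProd (x : ℕ → RunSet Q) : Set Q :=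
  {q | ∃ (r : ℕ → Q) (c : ℕ → Bool), r 0 = q ∧ (∀ n, (x n).Mem (r n) (c n) (r (n + 1))) ∧
    ∀ N, ∃ n, N ≤ n ∧ c n = true}

/-- The boundaries of the blocks of a factorisation. -/
def blockStart (k : ℕ → ℕ) (n : ℕ) : ℕ := Nat.casesOn n 0 fun i => k i + 1

theorem blockStart_strictMono {k : ℕ → ℕ} (hk : StrictMono k) : StrictMono (blockStart k) :=
  strictMono_nat_of_lt_succ fun n => by
    cases n with
    | zero => simp [blockStart]
    | succ n => simpa [blockStart] using hk (Nat.lt_succ_self n)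

theorem exists_blockStart_le {k : ℕ → ℕ} (hk : StrictMono k) (l : ℕ) :
    ∃ n, blockStart k n ≤ l ∧ l < blockStart k (n + 1) := by
  classical
  have hex : ∃ n, l < blockStart k (n + 1) :=
    ⟨l, Nat.lt_of_lt_of_le (Nat.lt_succ_self l) ((blockStart_strictMono hk).le_apply)⟩
  refine ⟨Nat.find hex, ?_, Nat.find_spec hex⟩
  cases hn : Nat.find hex with
  | zero => exact Nat.zero_le l
  | succ n => exact not_lt.1 (Nat.find_min hex (by omega : n < Nat.find hex))

theorem RunSet.mem_block {x : ℕ → RunSet Q} {k : ℕ → ℕ} (hk : StrictMono k) {n : ℕ} {p q : Q}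
    {b : Bool} :
    RunSet.Mem (Nat.casesOn n (blockProd x 0 (k 0))
      (fun i => blockProd x (k i + 1) (k (i + 1) - k i - 1)) : RunSet Q) p b q ↔
    ∃ (r : ℕ → Q) (c : ℕ → Bool), r (blockStart k n) = p ∧ r (blockStart k (n + 1)) = q ∧
      (∀ l, blockStart k n ≤ l → l < blockStart k (n + 1) → (x l).Mem (r l) (c l) (r (l + 1))) ∧
      (b = true ↔ ∃ l, blockStart k n ≤ l ∧ l < blockStart k (n + 1) ∧ c l = true) := by
  have key : ∀ m, (Nat.casesOn n (blockProd x 0 (k 0))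
      (fun i => blockProd x (k i + 1) (k (i + 1) - k i - 1)) : RunSet Q) =
        blockProd x (blockStart k n) m ∧ blockStart k n + m + 1 = blockStart k (n + 1) →
    (RunSet.Mem (Nat.casesOn n (blockProd x 0 (k 0))
      (fun i => blockProd x (k i + 1) (k (i + 1) - k i - 1)) : RunSet Q) p b q ↔
    ∃ (r : ℕ → Q) (c : ℕ → Bool), r (blockStart k n) = p ∧ r (blockStart k (n + 1)) = q ∧
      (∀ l, blockStart k n ≤ l → l < blockStart k (n + 1) → (x l).Mem (r l) (c l) (r (l + 1))) ∧
      (b = true ↔ ∃ l, blockStart k n ≤ l ∧ l < blockStart k (n + 1) ∧ c l = true)) := by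
    rintro m ⟨h₁, h₂⟩
    rw [h₁, RunSet.mem_blockProd, ← h₂]
    simp only [Nat.lt_succ_iff]
  cases n with
  | zero => exact key (k 0) ⟨rfl, by simp [blockStart]⟩
  | succ n =>
    refine key (k (n + 1) - k n - 1) ⟨rfl, ?_⟩
    have := hk (Nat.lt_succ_self n)
    simp only [blockStart, Nat.succ_eq_add_one] at this ⊢
    omega

/-- A run is cut at the block boundaries; conversely, paths through the blocks are glued by using at
each position the path of its block. A block is marked exactly if one of its steps is, so infinitely
many marks are preserved both ways. -/
theorem RunSet.omegaProd_block (x : ℕ → RunSet Q) (k : ℕ → ℕ) (hk : StrictMono k) :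
    omegaProd x = omegaProd (fun n => Nat.casesOn n (blockProd x 0 (k 0))
      (fun i => blockProd x (k i + 1) (k (i + 1) - k i - 1))) := by
  classical
  have hj := blockStart_strictMono hk
  apply Set.ext
  intro q
  constructor
  · rintro ⟨r, c, rfl, hr, hc⟩
    refine ⟨fun n => r (blockStart k n),
      fun n => decide (∃ l, blockStart k n ≤ l ∧ l < blockStart k (n + 1) ∧ c l = true), rfl,
      fun n => (RunSet.mem_block hk).2 ⟨r, c, rfl, rfl, fun l _ _ => hr l, by simp⟩, fun N => ?_⟩
    obtain ⟨l, hl, hcl⟩ := hc (blockStart k N)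
    obtain ⟨n, hn, hn'⟩ := exists_blockStart_le hk l
    refine ⟨n, ?_, by simpa using ⟨l, hn, hn', hcl⟩⟩
    exact Nat.lt_succ_iff.1 (hj.lt_iff_lt.1 (lt_of_le_of_lt hl hn'))
  · rintro ⟨r', c', rfl, hr, hc⟩
    choose r c h₁ h₂ h₃ h₄ using fun n => (RunSet.mem_block hk).1 (hr n)
    choose blk hblk hblk' using exists_blockStart_le hk
    have huniq : ∀ l n, blockStart k n ≤ l → l < blockStart k (n + 1) → blk l = n := by
      intro l n hn hn'
      have e₁ := hj.lt_iff_lt.1 (lt_of_le_of_lt hn (hblk' l))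
      have e₂ := hj.lt_iff_lt.1 (lt_of_le_of_lt (hblk l) hn')
      omega
    refine ⟨fun l => r (blk l) l, fun l => c (blk l) l, ?_, fun l => ?_, fun N => ?_⟩
    · have h0 : blk 0 = 0 := huniq 0 0 le_rfl (hj (Nat.lt_succ_self 0))
      dsimp only
      rw [h0]
      exact h₁ 0
    · have hstep := h₃ (blk l) l (hblk l) (hblk' l)
      dsimp only
      rcases Nat.lt_or_ge (l + 1) (blockStart k (blk l + 1)) with hlt | hge
      · rw [huniq (l + 1) (blk l) (by have := hblk l; omega) hlt]
        exact hstep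
      · have hl : l + 1 = blockStart k (blk l + 1) := by have := hblk' l; omega
        rw [huniq (l + 1) (blk l + 1) hl.ge (by rw [hl]; exact hj (Nat.lt_succ_self _))]
        have e₁ := h₂ (blk l)
        have e₂ := h₁ (blk l + 1)
        rw [← hl] at e₁ e₂
        rw [e₂, ← e₁]
        exact hstep
    · obtain ⟨n, hn, hcn⟩ := hc N
      obtain ⟨l, hl, hl', hcl⟩ := (h₄ n).1 hcn
      refine ⟨l, hn.trans (hj.le_apply.trans hl), ?_⟩
      dsimp only
      rw [huniq l n hl hl', hcl]

/-- The ω-semigroup of the sets of triples. -/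
def runSemigroup (Q : Type u) : OmegaSemigroup.{u, u} where
  F := RunSet Q
  I := Set Q
  mix x S := {q | ∃ b q', x.Mem q b q' ∧ q' ∈ S}
  prod := RunSet.omegaProd
  mix_assoc x y S := by
    apply Set.ext
    intro q
    constructor
    · rintro ⟨b, q', ⟨r, c, c', h₁, h₂, -⟩, hq'⟩
      exact ⟨c, r, h₁, c', q', h₂, hq'⟩
    · rintro ⟨c, r, h₁, c', q', h₂, hq'⟩
      exact ⟨c || c', q', ⟨r, c, c', h₁, h₂, rfl⟩, hq'⟩
  prod_block := RunSet.omegaProd_block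
  mix_prod y x := by
    apply Set.ext
    intro q
    constructor
    · rintro ⟨b, q', hq, r, c, rfl, hr, hc⟩
      refine ⟨fun n => Nat.casesOn n q r, fun n => Nat.casesOn n b c, rfl, fun n => ?_, fun N => ?_⟩
      · cases n with
        | zero => exact hq
        | succ n => exact hr n
      · obtain ⟨n, hn, hcn⟩ := hc N
        exact ⟨n + 1, by omega, hcn⟩
    · rintro ⟨r, c, rfl, hr, hc⟩
      refine ⟨c 0, r 1, hr 0, fun n => r (n + 1), fun n => c (n + 1), rfl, fun n => hr (n + 1),
        fun N => ?_⟩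
      obtain ⟨n, hn, hcn⟩ := hc (N + 1)
      exact ⟨n - 1, by omega, by simpa only [Nat.sub_add_cancel (show 1 ≤ n by omega)] using hcn⟩

/-- The triples of the transitions with the letter `a`, marked at the accepting states. -/
def letterRuns {A : Type v} (B : Buchi A Q) (a : A) : RunSet Q :=
  {t | (t.1, a, t.2.2) ∈ B.trans ∧ (t.2.1 = true ↔ t.1 ∈ B.accept)}

theorem recognises_runSemigroup {A : Type v} (B : Buchi A Q) :
    Recognises (runSemigroup Q) (letterRuns B) {S : Set Q | ∃ q ∈ S, q ∈ B.start}
      {α | B.Accepts α} := by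
  classical
  intro α
  constructor
  · rintro ⟨r, h₀, hr, hacc⟩
    refine ⟨r 0, ⟨r, fun n => decide (r n ∈ B.accept), rfl, fun n => ⟨hr n, by simp⟩, fun N => ?_⟩,
      h₀⟩
    obtain ⟨n, hn, hrn⟩ := hacc N
    exact ⟨n, hn, by simpa using hrn⟩
  · rintro ⟨q, ⟨r, c, rfl, hr, hc⟩, h₀⟩
    refine ⟨r, h₀, fun n => (hr n).1, fun N => ?_⟩
    obtain ⟨n, hn, hcn⟩ := hc N
    exact ⟨n, hn, (hr n).2.1 hcn⟩

/-- If `i` is too large, two terms with indices `a < b ≤ i` agree, and iteration from there on lets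
`i` be lowered by `b - a`. -/
theorem exists_lt_card_iterate_eq {S : Type*} [Finite S] (y : ℕ → S) (g : S → S)
    (hy : ∀ n, y (n + 1) = g (y n)) (i : ℕ) : ∃ j < Nat.card S, y j = y i := by
  induction i using Nat.strong_induction_on with
  | _ i ih =>
    by_cases hi : i < Nat.card S
    · exact ⟨i, hi, rfl⟩
    have hninj : ¬ Function.Injective (fun a : Fin (i + 1) => y a) := fun hinj => by
      have := Nat.card_le_card_of_injective _ hinj
      rw [Nat.card_fin] at this
      omega
    rw [Function.Injective] at hninj
    push Not at hninj
    obtain ⟨a, b, hab, hne⟩ := hninj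
    have hshift : ∀ (a b n : ℕ), y a = y b → y (a + n) = y (b + n) := by
      intro a b n hab
      induction n with
      | zero => exact hab
      | succ n ih => rw [← Nat.add_assoc, ← Nat.add_assoc, hy, hy, ih]
    have key : ∀ a b : Fin (i + 1), y a = y b → a < b → ∃ j < Nat.card S, y j = y i := by
      intro a b hab hlt
      have hlt' : (a : ℕ) < b := hlt
      have hb := b.2
      obtain ⟨j, hj, hji⟩ := ih (a + (i - b)) (by omega)
      refine ⟨j, hj, ?_⟩
      rw [hji, hshift a b (i - b) hab, show (b : ℕ) + (i - b) = i by omega]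
    rcases lt_or_gt_of_ne hne with h | h
    · exact key a b hab h
    · exact key b a hab.symm h

theorem blockProd_const {S : Type*} [Semigroup S] (x : S) (i n : ℕ) :
    blockProd (fun _ => x) i n = blockProd (fun _ => x) 0 n := by
  induction n with
  | zero => rfl
  | succ n ih => rw [blockProd, blockProd, ih]

/-- The infinite power of a set of triples over a finite set of states. -/
theorem RunSet.mem_omegaProd_const [Finite Q] [Finite (RunSet Q)] (x : RunSet Q) (q : Q) :
    q ∈ omegaProd (fun _ => x) ↔ ∃ i < Nat.card (RunSet Q), ∃ j < Nat.card (RunSet Q), ∃ q' b,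
      (blockProd (fun _ => x) 0 i).Mem q b q' ∧ (blockProd (fun _ => x) 0 j).Mem q' true q' := by
  constructor
  · rintro ⟨r, c, rfl, hr, hc⟩
    -- Some state recurs infinitely often. The stem ends at its visit `n₁ ≥ 1`, and the loop lasts
    -- until a visit `n₃` after a mark `n₂`. Both powers recur with small exponents; `blockProd`
    -- with index `i` is the power `i + 1`.
    obtain ⟨q', hq'⟩ : ∃ q', ∀ N, ∃ n, N ≤ n ∧ r n = q' := by
      by_contra hno
      push Not at hno
      choose N hN using hno
      obtain ⟨B, hB⟩ := (Set.finite_range N).bddAbove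
      exact hN (r B) B (hB ⟨_, rfl⟩) rfl
    obtain ⟨n₁, hn₁, hr₁⟩ := hq' 1
    obtain ⟨n₂, hn₂, hc₂⟩ := hc n₁
    obtain ⟨n₃, hn₃, hr₃⟩ := hq' (n₂ + 1)
    obtain ⟨i, hi, hxi⟩ := exists_lt_card_iterate_eq (blockProd (fun _ => x) 0) (· * x)
      (fun n => rfl) (n₁ - 1)
    obtain ⟨j, hj, hxj⟩ := exists_lt_card_iterate_eq (blockProd (fun _ => x) 0) (· * x)
      (fun n => rfl) (n₃ - n₁ - 1)
    classical
    refine ⟨i, hi, j, hj, q', decide (∃ l, 0 ≤ l ∧ l ≤ 0 + (n₁ - 1) ∧ c l = true), ?_, ?_⟩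
    · rw [hxi, RunSet.mem_blockProd]
      exact ⟨r, c, rfl, by rw [← hr₁]; congr 1; omega, fun l _ _ => hr l, by simp⟩
    · rw [hxj, ← blockProd_const x n₁, RunSet.mem_blockProd]
      refine ⟨r, c, hr₁, by rw [← hr₃]; congr 1; omega, fun l _ _ => hr l, ?_⟩
      exact ⟨fun _ => ⟨n₂, hn₂, by omega, hc₂⟩, fun _ => rfl⟩
  · rintro ⟨i, -, j, -, q', b, hi, hj⟩
    -- Last positions of the blocks: a stem of length `i + 1`, then loops of length `j + 1`.
    have hk : StrictMono fun n => i + n * (j + 1) :=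
      strictMono_nat_of_lt_succ fun n => by rw [Nat.succ_mul]; omega
    rw [omegaProd_block (fun _ => x) _ hk]
    refine ⟨fun n => Nat.casesOn n q fun _ => q', fun n => Nat.casesOn n b fun _ => true, rfl,
      fun n => ?_, fun N => ⟨N + 1, by omega, rfl⟩⟩
    cases n with
    | zero => simpa using hi
    | succ n =>
      simp only
      rw [blockProd_const, show i + (n + 1) * (j + 1) - (i + n * (j + 1)) - 1 = j by
        rw [Nat.succ_mul]; omega]
      exact hj

end Runs

/-! ### Primitive recursive functions on lists -/

/-- The position of `c` in the list `E`. -/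
def codeIdx {γ : Type*} [DecidableEq γ] (E : List γ) (c : γ) : ℕ := E.idxOf c

section PrimrecLists

variable {α β γ : Type*} [Primcodable α] [Primcodable β] [Primcodable γ]

-- Primitive recursive functions are closed under the list operations used by the algorithms. The
-- closure rules are stated for composites, so that `fun_prop` can take each algorithm apart along
-- its definition.
attribute [fun_prop] Primrec
attribute [fun_prop] Primrec.id Primrec.const Primrec.comp Primrec.pair

namespace Primrec

@[fun_prop]
theorem fst_comp {f : α → β × γ} (hf : Primrec f) : Primrec fun a => (f a).1 := fst.comp hf

@[fun_prop]
theorem snd_comp {f : α → β × γ} (hf : Primrec f) : Primrec fun a => (f a).2 := snd.comp hf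

@[fun_prop]
theorem add_comp {f g : α → ℕ} (hf : Primrec f) (hg : Primrec g) :
    Primrec fun a => f a + g a := nat_add.comp hf hg

@[fun_prop]
theorem sub_comp {f g : α → ℕ} (hf : Primrec f) (hg : Primrec g) :
    Primrec fun a => f a - g a := nat_sub.comp hf hg

@[fun_prop]
theorem mul_comp {f g : α → ℕ} (hf : Primrec f) (hg : Primrec g) :
    Primrec fun a => f a * g a := nat_mul.comp hf hg

@[fun_prop]
theorem pow_comp {f g : α → ℕ} (hf : Primrec f) (hg : Primrec g) :
    Primrec fun a => f a ^ g a :=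
  (Primrec₂.unpaired'.1 Nat.Primrec.pow).comp hf hg

@[fun_prop]
theorem and_comp {f g : α → Bool} (hf : Primrec f) (hg : Primrec g) :
    Primrec fun a => f a && g a := Primrec.and.comp hf hg

@[fun_prop]
theorem or_comp {f g : α → Bool} (hf : Primrec f) (hg : Primrec g) :
    Primrec fun a => f a || g a := Primrec.or.comp hf hg

@[fun_prop]
theorem not_comp {f : α → Bool} (hf : Primrec f) : Primrec fun a => !f a := Primrec.not.comp hf

@[fun_prop]
theorem cond_comp {c : α → Bool} {f g : α → β} (hc : Primrec c) (hf : Primrec f)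
    (hg : Primrec g) : Primrec fun a => bif c a then f a else g a := cond hc hf hg

@[fun_prop]
theorem decide_eq_comp [DecidableEq β] {f g : α → β} (hf : Primrec f) (hg : Primrec g) :
    Primrec fun a => decide (f a = g a) := (Primrec.eq.comp hf hg).decide

@[fun_prop]
theorem map_comp {f : α → List β} {g : α → β → γ} (hf : Primrec f)
    (hg : Primrec fun p : α × β => g p.1 p.2) : Primrec fun a => (f a).map (g a) := list_map hf hg

@[fun_prop]
theorem flatMap_comp {f : α → List β} {g : α → β → List γ} (hf : Primrec f)
    (hg : Primrec fun p : α × β => g p.1 p.2) : Primrec fun a => (f a).flatMap (g a) :=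
  list_flatMap hf hg

@[fun_prop]
theorem foldr_comp {f : α → List β} {g : α → γ} {h : α → β → γ → γ} (hf : Primrec f)
    (hg : Primrec g) (hh : Primrec fun p : α × β × γ => h p.1 p.2.1 p.2.2) :
    Primrec fun a => (f a).foldr (h a) (g a) :=
  list_foldr (h := fun a p => h a p.1 p.2) hf hg hh

@[fun_prop]
theorem foldl_comp {f : α → List β} {g : α → γ} {h : α → γ → β → γ} (hf : Primrec f)
    (hg : Primrec g) (hh : Primrec fun p : α × γ × β => h p.1 p.2.1 p.2.2) :
    Primrec fun a => (f a).foldl (h a) (g a) :=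
  list_foldl (h := fun a p => h a p.1 p.2) hf hg hh

@[fun_prop]
theorem cons_comp {f : α → β} {g : α → List β} (hf : Primrec f) (hg : Primrec g) :
    Primrec fun a => f a :: g a := list_cons.comp hf hg

@[fun_prop]
theorem append_comp {f g : α → List β} (hf : Primrec f) (hg : Primrec g) :
    Primrec fun a => f a ++ g a := list_append.comp hf hg

@[fun_prop]
theorem range_comp {f : α → ℕ} (hf : Primrec f) : Primrec fun a => List.range (f a) :=
  list_range.comp hf

@[fun_prop]
theorem length_comp {f : α → List β} (hf : Primrec f) : Primrec fun a => (f a).length :=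
  list_length.comp hf

@[fun_prop]
theorem head?_comp {f : α → List β} (hf : Primrec f) : Primrec fun a => (f a).head? :=
  list_head?.comp hf

@[fun_prop]
theorem tail_comp {f : α → List β} (hf : Primrec f) : Primrec fun a => (f a).tail :=
  list_tail.comp hf

@[fun_prop]
theorem some_comp {f : α → β} (hf : Primrec f) : Primrec fun a => some (f a) :=
  option_some.comp hf

@[fun_prop]
theorem getD_comp {f : α → List β} {g : α → ℕ} (hf : Primrec f) (hg : Primrec g) (d : β) :
    Primrec fun a => (f a).getD (g a) d := (list_getD d).comp hf hg

@[fun_prop]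
theorem codeIdx_comp [DecidableEq β] {f : α → β} {g : α → List β} (hg : Primrec g)
    (hf : Primrec f) : Primrec fun a => codeIdx (g a) (f a) := list_idxOf.comp hf hg

@[fun_prop]
theorem any_comp {f : α → List β} {g : α → β → Bool} (hf : Primrec f)
    (hg : Primrec fun p : α × β => g p.1 p.2) : Primrec fun a => (f a).any (g a) :=
  Primrec.of_eq (f := fun a => (f a).foldr (fun b s => g a b || s) false) (by fun_prop) fun a => by
    induction f a <;> simp_all

@[fun_prop]
theorem all_comp {f : α → List β} {g : α → β → Bool} (hf : Primrec f)
    (hg : Primrec fun p : α × β => g p.1 p.2) : Primrec fun a => (f a).all (g a) :=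
  Primrec.of_eq (f := fun a => (f a).foldr (fun b s => g a b && s) true) (by fun_prop) fun a => by
    induction f a <;> simp_all

@[fun_prop]
theorem filter_comp {f : α → List β} {g : α → β → Bool} (hf : Primrec f)
    (hg : Primrec fun p : α × β => g p.1 p.2) : Primrec fun a => (f a).filter (g a) :=
  Primrec.of_eq (f := fun a => (f a).flatMap fun b => bif g a b then [b] else []) (by fun_prop)
    fun a => by
      induction f a with
      | nil => rfl
      | cons b l ih => rw [List.flatMap_cons, ih, List.filter_cons]; cases g a b <;> simp

@[fun_prop]
theorem decide_mem_comp {f : α → β} {g : α → List β} [DecidablePred fun a => f a ∈ g a]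
    (hf : Primrec f) (hg : Primrec g) : Primrec fun a => decide (f a ∈ g a) := by
  classical
  refine Primrec.of_eq (f := fun a => (g a).any fun b => decide (b = f a)) (by fun_prop)
    fun a => ?_
  rw [Bool.eq_iff_iff]
  simp

@[fun_prop]
theorem product_comp {f : α → List β} {g : α → List γ} (hf : Primrec f) (hg : Primrec g) :
    Primrec fun a => (f a).product (g a) :=
  Primrec.of_eq (f := fun a => (f a).flatMap fun b => (g a).map fun c => (b, c)) (by fun_prop)
    fun _ => rfl

@[fun_prop]
theorem sublists'_comp {f : α → List β} (hf : Primrec f) : Primrec fun a => (f a).sublists' :=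
  Primrec.of_eq (f := fun a => (f a).foldr (fun b s => s ++ s.map (b :: ·)) [[]]) (by fun_prop)
    fun a => by induction f a with
      | nil => rfl
      | cons b l ih => rw [List.foldr_cons, ih, List.sublists'_cons]

@[fun_prop]
theorem encode_comp {f : α → β} (hf : Primrec f) : Primrec fun a => Encodable.encode (f a) :=
  Primrec.encode.comp hf

end Primrec

end PrimrecLists

/-! ### Numberings and codes of sets -/

section Codes

/-- A complete list without repetitions of codes of the elements of `X` numbers these elements. -/
theorem exists_numbering {X : Type*} {γ : Type*} [DecidableEq γ] {code : X → γ}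
    (hinj : Function.Injective code) {E : List γ} (hE : E.Nodup)
    (hmem : ∀ l, l ∈ E ↔ ∃ x, code x = l) :
    ∃ e : X ≃ Fin E.length, (∀ x, (e x : ℕ) = codeIdx E (code x)) ∧
      E = List.ofFn fun i => code (e.symm i) := by
  have hlt : ∀ x, E.idxOf (code x) < E.length := fun x =>
    List.idxOf_lt_length_iff.2 ((hmem _).2 ⟨x, rfl⟩)
  choose dec hdec using fun i : Fin E.length => (hmem E[i]).1 (List.getElem_mem i.2)
  let e : X ≃ Fin E.length :=
    { toFun := fun x => ⟨E.idxOf (code x), hlt x⟩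
      invFun := dec
      left_inv := fun x => hinj (by rw [hdec]; exact List.getElem_idxOf (hlt x))
      right_inv := fun i => Fin.ext (by
        simp only [hdec]
        exact hE.idxOf_getElem i i.2) }
  refine ⟨e, fun x => rfl, ?_⟩
  apply List.ext_getElem
  · simp
  · intro i h₁ h₂
    rw [List.getElem_ofFn]
    exact (hdec ⟨i, h₁⟩).symm

open Classical in
/-- The code of a set: the list of the codes of its elements, in the order of the list `l`. -/
noncomputable def setCode {S : Type*} {γ : Type*} (l : List γ) (ι : S → γ) (x : Set S) : List γ :=
  l.filter fun c => ∃ s ∈ x, ι s = c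

theorem mem_setCode {S : Type*} {γ : Type*} {l : List γ} {ι : S → γ} (hl : ∀ s, ι s ∈ l)
    {x : Set S} {c : γ} : c ∈ setCode l ι x ↔ ∃ s ∈ x, ι s = c := by
  simp only [setCode, List.mem_filter, decide_eq_true_eq]
  exact ⟨fun h => h.2, fun ⟨s, hs, h⟩ => ⟨h ▸ hl s, s, hs, h⟩⟩

theorem setCode_injective {S : Type*} {γ : Type*} {l : List γ} {ι : S → γ} (hl : ∀ s, ι s ∈ l)
    (hι : Function.Injective ι) : Function.Injective (setCode l ι) := by
  intro x y hxy
  ext s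
  have h₁ := mem_setCode hl (x := x) (c := ι s)
  have h₂ := mem_setCode hl (x := y) (c := ι s)
  rw [hxy, h₂] at h₁
  simpa [hι.eq_iff] using h₁.symm

theorem List.Sublist.eq_filter_mem {γ : Type*} [DecidableEq γ] {l l' : List γ} (h : l'.Sublist l)
    (hl : l.Nodup) : l' = l.filter fun c => decide (c ∈ l') := by
  have h₁ := h.filter fun c => decide (c ∈ l')
  rw [List.filter_eq_self.2 (by simp)] at h₁
  refine h₁.eq_of_length_le ?_
  refine ((hl.filter _).subperm fun c hc => ?_).length_le
  simpa using (List.mem_filter.1 hc).2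

/-- A sublist of a list without repetitions is determined by its elements, so the sublists are
exactly the codes of sets. -/
theorem mem_sublists'_iff_setCode {S : Type*} {γ : Type*} {l : List γ} {ι : S → γ}
    (hnd : l.Nodup) (hl : ∀ c, c ∈ l ↔ ∃ s, ι s = c) (l' : List γ) :
    l' ∈ l.sublists' ↔ ∃ x : Set S, setCode l ι x = l' := by
  classical
  rw [List.mem_sublists']
  constructor
  · intro h
    refine ⟨{s | ι s ∈ l'}, ?_⟩
    conv_rhs => rw [h.eq_filter_mem hnd]
    apply List.filter_congr
    intro c hc
    obtain ⟨s, rfl⟩ := (hl c).1 hc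
    rw [decide_eq_decide]
    constructor
    · rintro ⟨t, ht, h⟩
      exact h ▸ ht
    · exact fun h => ⟨s, h, rfl⟩
  · rintro ⟨x, rfl⟩
    exact List.filter_sublist

theorem setCode_eq_filter {S : Type*} {γ : Type*} {l : List γ} {ι : S → γ}
    (hl : ∀ c, c ∈ l ↔ ∃ s, ι s = c) (hι : Function.Injective ι) {x : Set S} {P : γ → Bool}
    (hP : ∀ s, s ∈ x ↔ P (ι s) = true) : setCode l ι x = l.filter P := by
  classical
  apply List.filter_congr
  intro c hc
  obtain ⟨s, rfl⟩ := (hl c).1 hc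
  rw [Bool.eq_iff_iff, ← hP s, decide_eq_true_eq]
  constructor
  · rintro ⟨t, ht, h⟩
    exact hι h ▸ ht
  · exact fun h => ⟨s, h, rfl⟩

end Codes

/-! ### Computing the ω-semigroup of a Büchi automaton -/

section RunCodes

/-- The triples over the states `0, …, n-1`. -/
def allTriples (n : ℕ) : List (ℕ × Bool × ℕ) :=
  (List.range n).product ([false, true].product (List.range n))

/-- The code of a triple. -/
def tripleCode {n : ℕ} (t : Fin n × Bool × Fin n) : ℕ × Bool × ℕ := (t.1, t.2.1, t.2.2)

/-- The code of a set of triples. -/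
noncomputable def runCode {n : ℕ} (x : RunSet (Fin n)) : List (ℕ × Bool × ℕ) :=
  setCode (allTriples n) tripleCode x

/-- The code of a set of states. -/
noncomputable def stateSetCode {n : ℕ} (x : Set (Fin n)) : List ℕ :=
  setCode (List.range n) (fun q : Fin n => (q : ℕ)) x

theorem tripleCode_injective {n : ℕ} : Function.Injective (tripleCode (n := n)) := by
  rintro ⟨p, b, q⟩ ⟨p', b', q'⟩ h
  simp only [tripleCode, Prod.mk.injEq] at h
  obtain ⟨h₁, h₂, h₃⟩ := h
  rw [Fin.ext h₁, h₂, Fin.ext h₃]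

theorem mem_allTriples {n : ℕ} (c : ℕ × Bool × ℕ) :
    c ∈ allTriples n ↔ ∃ t : Fin n × Bool × Fin n, tripleCode t = c := by
  obtain ⟨p, b, q⟩ := c
  rw [allTriples, List.pair_mem_product, List.pair_mem_product, List.mem_range, List.mem_range]
  constructor
  · rintro ⟨hp, -, hq⟩
    exact ⟨(⟨p, hp⟩, b, ⟨q, hq⟩), rfl⟩
  · rintro ⟨t, ht⟩
    simp only [tripleCode, Prod.mk.injEq] at ht
    obtain ⟨rfl, rfl, rfl⟩ := ht
    exact ⟨t.1.2, by cases t.2.1 <;> simp, t.2.2.2⟩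

theorem nodup_allTriples (n : ℕ) : (allTriples n).Nodup :=
  List.nodup_range.product ((by decide : [false, true].Nodup).product List.nodup_range)

theorem mem_range_iff_fin {n : ℕ} (c : ℕ) : c ∈ List.range n ↔ ∃ q : Fin n, (q : ℕ) = c := by
  rw [List.mem_range]
  exact ⟨fun h => ⟨⟨c, h⟩, rfl⟩, fun ⟨q, hq⟩ => hq ▸ q.2⟩

theorem mem_runCode {n : ℕ} {x : RunSet (Fin n)} {c : ℕ × Bool × ℕ} :
    c ∈ runCode x ↔ ∃ p b q, x.Mem p b q ∧ ((p : ℕ), b, (q : ℕ)) = c := by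
  refine (mem_setCode fun s => (mem_allTriples _).2 ⟨s, rfl⟩).trans ?_
  constructor
  · rintro ⟨⟨p, b, q⟩, h, h'⟩
    exact ⟨p, b, q, h, h'⟩
  · rintro ⟨p, b, q, h, h'⟩
    exact ⟨(p, b, q), h, h'⟩

theorem mem_stateSetCode {n : ℕ} {x : Set (Fin n)} {c : ℕ} :
    c ∈ stateSetCode x ↔ ∃ q ∈ x, (q : ℕ) = c := by
  rw [stateSetCode, mem_setCode fun s => (mem_range_iff_fin _).2 ⟨s, rfl⟩]

theorem runCode_eq_filter {n : ℕ} {x : RunSet (Fin n)} {P : ℕ × Bool × ℕ → Bool}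
    (hP : ∀ p b q, x.Mem p b q ↔ P (p, b, q) = true) : runCode x = (allTriples n).filter P :=
  setCode_eq_filter mem_allTriples tripleCode_injective fun ⟨p, b, q⟩ => hP p b q

theorem stateSetCode_eq_filter {n : ℕ} {x : Set (Fin n)} {P : ℕ → Bool}
    (hP : ∀ q : Fin n, q ∈ x ↔ P q = true) : stateSetCode x = (List.range n).filter P :=
  setCode_eq_filter mem_range_iff_fin Fin.val_injective hP

/-- The product of sets of triples, on codes. -/
def mulRuns (n : ℕ) (x y : List (ℕ × Bool × ℕ)) : List (ℕ × Bool × ℕ) :=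
  (allTriples n).filter fun t => x.any fun r => y.any fun s =>
    decide (r.1 = t.1) && decide (r.2.2 = s.1) && decide (s.2.2 = t.2.2) &&
      decide (t.2.1 = (r.2.1 || s.2.1))

theorem runCode_mul {n : ℕ} (x y : RunSet (Fin n)) :
    runCode (x * y) = mulRuns n (runCode x) (runCode y) := by
  apply runCode_eq_filter
  intro p b q
  simp only [List.any_eq_true, Bool.and_eq_true, decide_eq_true_eq, mem_runCode, RunSet.mem_mul]
  constructor
  · rintro ⟨r, c, c', h₁, h₂, rfl⟩
    exact ⟨_, ⟨_, _, _, h₁, rfl⟩, _, ⟨_, _, _, h₂, rfl⟩, by simp⟩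
  · rintro ⟨_, ⟨p', c, r, h₁, rfl⟩, _, ⟨r', c', q', h₂, rfl⟩, ⟨⟨hp, hr⟩, hq⟩, rfl⟩
    obtain rfl := Fin.ext hp
    obtain rfl := Fin.ext hr
    obtain rfl := Fin.ext hq
    exact ⟨r, c, c', h₁, h₂, rfl⟩

/-- The mixed product, on codes. -/
def mixRuns (n : ℕ) (x : List (ℕ × Bool × ℕ)) (S : List ℕ) : List ℕ :=
  (List.range n).filter fun q => x.any fun r => decide (r.1 = q) && decide (r.2.2 ∈ S)

theorem stateSetCode_mix {n : ℕ} (x : RunSet (Fin n)) (S : Set (Fin n)) :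
    stateSetCode ((runSemigroup (Fin n)).mix x S) = mixRuns n (runCode x) (stateSetCode S) := by
  apply stateSetCode_eq_filter
  intro q
  simp only [List.any_eq_true, Bool.and_eq_true, decide_eq_true_eq, mem_runCode, mem_stateSetCode]
  constructor
  · rintro ⟨b, q', h, hS⟩
    exact ⟨_, ⟨_, _, _, h, rfl⟩, rfl, q', hS, rfl⟩
  · rintro ⟨_, ⟨p', c, r, h, rfl⟩, hp, q', hS, hr⟩
    obtain rfl := Fin.ext hp
    obtain rfl := Fin.ext hr
    exact ⟨c, q', h, hS⟩

/-- The power `x^(i+1)`, on codes. -/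
def powRuns (n : ℕ) (x : List (ℕ × Bool × ℕ)) (i : ℕ) : List (ℕ × Bool × ℕ) :=
  (List.range i).foldl (fun y _ => mulRuns n y x) x

theorem runCode_blockProd {n : ℕ} (x : RunSet (Fin n)) (i : ℕ) :
    runCode (blockProd (fun _ => x) 0 i) = powRuns n (runCode x) i := by
  induction i with
  | zero => rfl
  | succ i ih => rw [blockProd, runCode_mul, ih, powRuns, powRuns, List.range_succ,
      List.foldl_append, List.foldl_cons, List.foldl_nil]

/-- There is a lasso from `q` with a stem in `x` and a marked loop in `y`. -/
def hasLasso (x y : List (ℕ × Bool × ℕ)) (q : ℕ) : Bool :=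
  x.any fun r => decide (r.1 = q) && decide ((r.2.2, true, r.2.2) ∈ y)

/-- The infinite power, on codes, with a bound `C` for the exponents. -/
def omegaRuns (n C : ℕ) (x : List (ℕ × Bool × ℕ)) : List ℕ :=
  (List.range n).filter fun q => (List.range C).any fun i => (List.range C).any fun j =>
    hasLasso (powRuns n x i) (powRuns n x j) q

instance {n : ℕ} : Finite (RunSet (Fin n)) := inferInstanceAs (Finite (Set (Fin n × Bool × Fin n)))

theorem stateSetCode_omega {n : ℕ} (x : RunSet (Fin n)) :
    stateSetCode ((runSemigroup (Fin n)).prod fun _ => x) =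
      omegaRuns n (Nat.card (RunSet (Fin n))) (runCode x) := by
  apply stateSetCode_eq_filter
  intro q
  refine (RunSet.mem_omegaProd_const x q).trans ?_
  simp only [hasLasso, List.any_eq_true, Bool.and_eq_true, decide_eq_true_eq, ← runCode_blockProd,
    mem_runCode, List.mem_range]
  constructor
  · rintro ⟨i, hi, j, hj, q', b, h₁, h₂⟩
    exact ⟨i, hi, j, hj, _, ⟨_, _, _, h₁, rfl⟩, rfl, _, _, _, h₂, rfl⟩
  · rintro ⟨i, hi, j, hj, _, ⟨p, b, r, h₁, rfl⟩, hp, r', b', r'', h₂, hr⟩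
    simp only [Prod.mk.injEq] at hr
    obtain rfl := Fin.ext hp
    obtain rfl := Fin.ext hr.1
    obtain rfl := Fin.ext hr.2.2
    obtain rfl := hr.2.1
    exact ⟨i, hi, j, hj, _, b, h₁, h₂⟩

/-- The triples of a letter, on codes. -/
def letterRunsCode (b : BuchiCode ℕ) (a : ℕ) : List (ℕ × Bool × ℕ) :=
  (allTriples b.1).filter fun t =>
    decide ((t.1, a, t.2.2) ∈ b.2.2.1) && decide (t.2.1 = decide (t.1 ∈ b.2.2.2))

theorem runCode_letterRuns {A : Type u} {k : ℕ} (e : A ≃ Fin k) (b : BuchiCode ℕ) (a : A) :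
    runCode (letterRuns (automatonOver e b) a) = letterRunsCode b (e a) := by
  apply runCode_eq_filter
  intro p c q
  simp only [Bool.and_eq_true, decide_eq_true_eq]
  have hc : c = decide ((p : ℕ) ∈ b.2.2.2) ↔ (c = true ↔ (p : ℕ) ∈ b.2.2.2) := by
    rw [Bool.eq_iff_iff, decide_eq_true_eq]
  rw [hc]
  constructor
  · rintro ⟨⟨_, h₁, rfl⟩, h₂⟩
    exact ⟨h₁, h₂⟩
  · rintro ⟨h₁, h₂⟩
    exact ⟨⟨_, h₁, rfl⟩, h₂⟩

/-- The algorithm that computes an ω-semigroup from a Büchi automaton. -/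
def recOfBuchi (x : ℕ × BuchiCode ℕ) : RecCode :=
  let n := x.2.1
  let E := (allTriples n).sublists'
  let I := (List.range n).sublists'
  (x.1, E.length, I.length,
    E.map fun r => E.map fun s => codeIdx E (mulRuns n r s),
    E.map fun r => I.map fun S => codeIdx I (mixRuns n r S),
    E.map fun r => codeIdx I (omegaRuns n E.length r),
    (List.range x.1).map fun a => codeIdx E (letterRunsCode x.2 a),
    I.map fun S => S.any fun q => decide (q ∈ x.2.2.1))

section

variable {α : Type*} [Primcodable α]

@[fun_prop]
theorem primrec_allTriples {f : α → ℕ} (hf : Primrec f) : Primrec fun a => allTriples (f a) := by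
  unfold allTriples
  fun_prop

@[fun_prop]
theorem primrec_mulRuns {f : α → ℕ} {g h : α → List (ℕ × Bool × ℕ)} (hf : Primrec f)
    (hg : Primrec g) (hh : Primrec h) : Primrec fun a => mulRuns (f a) (g a) (h a) := by
  unfold mulRuns
  fun_prop

@[fun_prop]
theorem primrec_mixRuns {f : α → ℕ} {g : α → List (ℕ × Bool × ℕ)} {h : α → List ℕ}
    (hf : Primrec f) (hg : Primrec g) (hh : Primrec h) :
    Primrec fun a => mixRuns (f a) (g a) (h a) := by
  unfold mixRuns
  fun_prop

@[fun_prop]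
theorem primrec_powRuns {f h : α → ℕ} {g : α → List (ℕ × Bool × ℕ)} (hf : Primrec f)
    (hg : Primrec g) (hh : Primrec h) : Primrec fun a => powRuns (f a) (g a) (h a) := by
  unfold powRuns
  fun_prop

@[fun_prop]
theorem primrec_hasLasso {f : α → ℕ} {g h : α → List (ℕ × Bool × ℕ)} (hg : Primrec g)
    (hh : Primrec h) (hf : Primrec f) : Primrec fun a => hasLasso (g a) (h a) (f a) := by
  unfold hasLasso
  fun_prop

@[fun_prop]
theorem primrec_omegaRuns {f h : α → ℕ} {g : α → List (ℕ × Bool × ℕ)} (hf : Primrec f)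
    (hh : Primrec h) (hg : Primrec g) : Primrec fun a => omegaRuns (f a) (h a) (g a) := by
  unfold omegaRuns
  fun_prop

@[fun_prop]
theorem primrec_letterRunsCode {f : α → BuchiCode ℕ} {g : α → ℕ} (hf : Primrec f)
    (hg : Primrec g) : Primrec fun a => letterRunsCode (f a) (g a) := by
  unfold letterRunsCode
  fun_prop

theorem primrec_recOfBuchi : Primrec recOfBuchi := by
  unfold recOfBuchi
  fun_prop

end

/-- Elements are numbered by the positions of their codes in the lists of sublists, so the computed
positions are the entries of the tables for these numberings. -/
theorem recOfBuchi_spec {A : Type u} {k : ℕ} (e : A ≃ Fin k) (b : BuchiCode ℕ) :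
    ∃ (M : OmegaSemigroup.{0, 0}) (m p : ℕ) (eF : M.F ≃ Fin m) (eI : M.I ≃ Fin p)
      (h : A → M.F) (H : Set M.I), recOfBuchi (k, b) = recCode e M eF eI h H ∧
        Recognises M h H {α | (automatonOver e b).Accepts α} := by
  classical
  obtain ⟨eF, heF, hE⟩ := exists_numbering (X := RunSet (Fin b.1)) (code := runCode)
    (E := (allTriples b.1).sublists')
    (setCode_injective (fun s => (mem_allTriples _).2 ⟨s, rfl⟩) tripleCode_injective)
    (List.nodup_sublists'.2 (nodup_allTriples b.1))
    (mem_sublists'_iff_setCode (nodup_allTriples b.1) mem_allTriples)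
  obtain ⟨eI, heI, hI⟩ := exists_numbering (X := Set (Fin b.1)) (code := stateSetCode)
    (E := (List.range b.1).sublists')
    (setCode_injective (fun s => (mem_range_iff_fin _).2 ⟨s, rfl⟩) Fin.val_injective)
    (List.nodup_sublists'.2 List.nodup_range)
    (mem_sublists'_iff_setCode List.nodup_range mem_range_iff_fin)
  refine ⟨runSemigroup (Fin b.1), _, _, eF, eI, letterRuns (automatonOver e b),
    {S : Set (Fin b.1) | ∃ q ∈ S, q ∈ (automatonOver e b).start}, ?_, recognises_runSemigroup _⟩
  -- The exponent bound used by the algorithm is the number of elements of the semigroup, as the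
  -- lasso criterion requires.
  have hcard : Nat.card (RunSet (Fin b.1)) = (allTriples b.1).sublists'.length := by
    rw [Nat.card_congr eF, Nat.card_fin]
  have hmapE : ∀ {δ : Type} (g : List (ℕ × Bool × ℕ) → δ),
      (allTriples b.1).sublists'.map g = List.ofFn fun i => g (runCode (eF.symm i)) := by
    intro δ g
    conv_lhs => rw [hE]
    rw [List.map_ofFn]
    rfl
  have hmapI : ∀ {δ : Type} (g : List ℕ → δ),
      (List.range b.1).sublists'.map g = List.ofFn fun i => g (stateSetCode (eI.symm i)) := by
    intro δ g
    conv_lhs => rw [hI]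
    rw [List.map_ofFn]
    rfl
  have hmapk : ∀ {δ : Type} (g : ℕ → δ),
      (List.range k).map g = List.ofFn fun i : Fin k => g (e (e.symm i)) := by
    intro δ g
    apply List.ext_getElem <;> simp
  have hmul : ∀ i j, codeIdx (allTriples b.1).sublists'
      (mulRuns b.1 (runCode (eF.symm i)) (runCode (eF.symm j))) = eF (eF.symm i * eF.symm j) := by
    intro i j
    rw [heF, runCode_mul]
  have hmix : ∀ i j, codeIdx (List.range b.1).sublists'
      (mixRuns b.1 (runCode (eF.symm i)) (stateSetCode (eI.symm j))) =
        eI ((runSemigroup (Fin b.1)).mix (eF.symm i) (eI.symm j)) := by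
    intro i j
    exact ((heI _).trans (congrArg _ (stateSetCode_mix _ _))).symm
  have homega : ∀ i, codeIdx (List.range b.1).sublists'
      (omegaRuns b.1 (allTriples b.1).sublists'.length (runCode (eF.symm i))) =
        eI ((runSemigroup (Fin b.1)).prod fun _ => eF.symm i) := by
    intro i
    have := stateSetCode_omega (eF.symm i)
    rw [hcard] at this
    exact ((heI _).trans (congrArg _ this)).symm
  have hletter : ∀ a, codeIdx (allTriples b.1).sublists' (letterRunsCode b (e a)) =
      eF (letterRuns (automatonOver e b) a) := by
    intro a
    rw [heF, runCode_letterRuns]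
  have hstart : ∀ S : Set (Fin b.1), ((stateSetCode S).any fun q => decide (q ∈ b.2.1)) =
      @decide (S ∈ {S : Set (Fin b.1) | ∃ q ∈ S, q ∈ (automatonOver e b).start})
        (Classical.propDecidable _) := by
    intro S
    refine Bool.eq_iff_iff.2
      (Iff.trans ?_ (@decide_eq_true_iff _ (Classical.propDecidable _)).symm)
    simp only [List.any_eq_true, decide_eq_true_eq, mem_stateSetCode]
    constructor
    · rintro ⟨_, ⟨q, hq, rfl⟩, h⟩
      exact ⟨q, hq, h⟩
    · rintro ⟨q, hq, h⟩
      exact ⟨_, ⟨q, hq, rfl⟩, h⟩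
  simp only [recOfBuchi, hmapE, hmapI, hmapk, hmul, hmix, homega, hletter, hstart]
  rfl

end RunCodes

/-! ### Computing the automaton for directive sequences -/

section Algorithms

/-- The lists of length `n` over the elements of `L`. -/
def listsOfLength {β : Type*} (L : List β) (n : ℕ) : List (List β) :=
  (List.range n).foldr (fun _ acc => acc.flatMap fun l => L.map fun x => x :: l) [[]]

theorem mem_listsOfLength {β : Type*} (L : List β) (n : ℕ) (l : List β) :
    l ∈ listsOfLength L n ↔ l.length = n ∧ ∀ x ∈ l, x ∈ L := by
  have key : ∀ (t : List ℕ) (l : List β),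
      l ∈ t.foldr (fun _ acc => acc.flatMap fun l => L.map fun x => x :: l) [[]] ↔
        l.length = t.length ∧ ∀ x ∈ l, x ∈ L := by
    intro t
    induction t with
    | nil =>
      intro l
      simp only [List.foldr_nil, List.mem_singleton, List.length_nil, List.length_eq_zero_iff]
      exact ⟨fun h => ⟨h, by simp [h]⟩, fun h => h.1⟩
    | cons c t ih =>
      intro l
      simp only [List.foldr_cons, List.mem_flatMap, List.mem_map, ih]
      constructor
      · rintro ⟨l', ⟨h₁, h₂⟩, x, hx, rfl⟩
        exact ⟨by simp [h₁], by simpa using ⟨hx, h₂⟩⟩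
      · rintro ⟨h₁, h₂⟩
        cases l with
        | nil => simp at h₁
        | cons x l =>
          exact ⟨l, ⟨by simpa using h₁, fun y hy => h₂ y (by simp [hy])⟩, x, h₂ x (by simp), rfl⟩
  rw [listsOfLength, key, List.length_range]

/-- The product of values, on codes (`0` is the code of the neutral element). -/
def mulElem (rc : RecCode) (i j : ℕ) : ℕ :=
  bif decide (i = 0) then j else bif decide (j = 0) then i
    else (rc.2.2.2.1.getD (i - 1) []).getD (j - 1) 0 + 1

/-- The value of a word, on codes. -/
def evalCode (rc : RecCode) (h : List ℕ) (x : List ℕ) : ℕ :=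
  x.foldl (fun p a => mulElem rc p (h.getD a 0)) 0

/-- Whether `x e^ω` is accepted, on codes. -/
def acceptCheck (rc : RecCode) (x e : ℕ) : Bool :=
  rc.2.2.2.2.2.2.2.getD ((rc.2.2.2.2.1.getD x []).getD (rc.2.2.2.2.2.1.getD e 0) 0) false

/-- `HeadTail`, on codes. -/
def headTailCheck (rc : RecCode) (c : SubstCode) (h : List ℕ) (a b z : ℕ) : Bool :=
  decide ((c.getD a []).head? = some b) && decide (z = evalCode rc h (c.getD a []).tail)

/-- The codes of the states that follow a directed word. -/
abbrev FollowCode := List ℕ × List ℕ × ℕ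

/-- The codes of the states that check a value. -/
abbrev ValueCode := ℕ × ℕ × Bool

/-- `FollowStep`, on codes. -/
def followCheck (rc : RecCode) (c : SubstCode) (d : FollowCode) (z : ℕ) (d' : FollowCode) : Bool :=
  decide (d'.1 = c.map fun x => evalCode rc d.1 x) &&
  (d.2.1.all fun b => d'.2.1.any fun a => headTailCheck rc c d.1 a b 0) &&
  ((decide (d.2.2 = 0) && decide (d'.2.2 = 0) &&
      (decide (z = 0) || d'.2.1.any fun a => decide (z = d'.1.getD a 0))) ||
    (decide (d.2.2 = 0) && !decide (d'.2.2 = 0) && decide (z = d'.1.getD (d'.2.2 - 1) 0)) ||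
    (!decide (d.2.2 = 0) && !decide (d'.2.2 = 0) &&
      headTailCheck rc c d.1 (d'.2.2 - 1) (d.2.2 - 1) z))

/-- `ValueStep`, on codes. -/
def valueCheck (rc : RecCode) (s : ValueCode) (z : ℕ) (s' : ValueCode) : Bool :=
  decide (s' = (mulElem rc s.1 z, s.2.1, false)) ||
  (decide (s.2.1 = 0) && !decide (mulElem rc s.1 z = 0) && !decide (s'.2.1 = 0) &&
    acceptCheck rc (mulElem rc s.1 z - 1) (s'.2.1 - 1) && decide (s' = (0, s'.2.1, false))) ||
  (!decide (s.2.1 = 0) && decide (mulElem rc s.1 z = s.2.1) && decide (s' = (0, s.2.1, true)))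

/-- The transitions, on codes. -/
def stepCheck (rc : RecCode) (q : FollowCode × ValueCode) (c : SubstCode)
    (r : FollowCode × ValueCode) : Bool :=
  (List.range (rc.2.1 + 1)).any fun z => followCheck rc c q.1 z r.1 && valueCheck rc q.2 z r.2

/-- The codes of all states. -/
def allStates (rc : RecCode) : List (FollowCode × ValueCode) :=
  ((listsOfLength ((List.range rc.2.1).map (· + 1)) rc.1).product
    ((List.range rc.1).sublists'.product (List.range (rc.1 + 1)))).product
  ((List.range (rc.2.1 + 1)).product ((List.range (rc.2.1 + 1)).product [false, true]))

/-- The code of the initial state. -/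
def startCode (rc : RecCode) : FollowCode × ValueCode :=
  ((rc.2.2.2.2.2.2.1.map (· + 1), [], 0), (0, 0, false))

/-- The automaton over the alphabet of the substitutions with codes in `W`. -/
def directingAutomaton (rc : RecCode) (W : List SubstCode) : BuchiCode SubstCode :=
  ((allStates rc).foldr (fun q n => Encodable.encode q + n) 1, [Encodable.encode (startCode rc)],
    (((allStates rc).product (W.product (allStates rc))).filter fun t =>
      stepCheck rc t.1 t.2.1 t.2.2).map
        fun t => (Encodable.encode t.1, t.2.1, Encodable.encode t.2.2),
    ((allStates rc).filter fun q => q.2.2.2).map fun q => Encodable.encode q)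

/-- The codes of all substitutions with images of length at most `N`. -/
def allSubstCodes (k N : ℕ) : List SubstCode :=
  listsOfLength ((List.range (N + 1)).flatMap fun n => listsOfLength (List.range k) n) k

/-- The automaton over the classes of substitutions. -/
def traceAutomaton (rc : RecCode) : BuchiCode SubstCode :=
  directingAutomaton rc (allSubstCodes rc.1 (segBound rc.1 rc.2.1))

/-- The automaton over a finite set of substitutions. -/
def listAutomaton (x : ℕ × BuchiCode ℕ × List SubstCode) : BuchiCode SubstCode :=
  directingAutomaton (recOfBuchi (x.1, x.2.1)) x.2.2

section Primrec

variable {α : Type*} [Primcodable α]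

@[fun_prop]
theorem primrec_listsOfLength {β : Type*} [Primcodable β] {f : α → List β} {g : α → ℕ}
    (hf : Primrec f) (hg : Primrec g) : Primrec fun a => listsOfLength (f a) (g a) := by
  unfold listsOfLength
  fun_prop

@[fun_prop]
theorem primrec_mulElem {f : α → RecCode} {i j : α → ℕ} (hf : Primrec f) (hi : Primrec i)
    (hj : Primrec j) : Primrec fun a => mulElem (f a) (i a) (j a) := by
  unfold mulElem
  fun_prop

@[fun_prop]
theorem primrec_evalCode {f : α → RecCode} {h x : α → List ℕ} (hf : Primrec f) (hh : Primrec h)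
    (hx : Primrec x) : Primrec fun a => evalCode (f a) (h a) (x a) := by
  unfold evalCode
  fun_prop

@[fun_prop]
theorem primrec_acceptCheck {f : α → RecCode} {i j : α → ℕ} (hf : Primrec f) (hi : Primrec i)
    (hj : Primrec j) : Primrec fun a => acceptCheck (f a) (i a) (j a) := by
  unfold acceptCheck
  fun_prop

@[fun_prop]
theorem primrec_headTailCheck {f : α → RecCode} {c : α → SubstCode} {h : α → List ℕ}
    {i j z : α → ℕ} (hf : Primrec f) (hc : Primrec c) (hh : Primrec h) (hi : Primrec i)
    (hj : Primrec j) (hz : Primrec z) :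
    Primrec fun a => headTailCheck (f a) (c a) (h a) (i a) (j a) (z a) := by
  unfold headTailCheck
  fun_prop

@[fun_prop]
theorem primrec_followCheck {f : α → RecCode} {c : α → SubstCode} {d d' : α → FollowCode}
    {z : α → ℕ} (hf : Primrec f) (hc : Primrec c) (hd : Primrec d) (hz : Primrec z)
    (hd' : Primrec d') : Primrec fun a => followCheck (f a) (c a) (d a) (z a) (d' a) := by
  unfold followCheck
  fun_prop

@[fun_prop]
theorem primrec_valueCheck {f : α → RecCode} {s s' : α → ValueCode} {z : α → ℕ}
    (hf : Primrec f) (hs : Primrec s) (hz : Primrec z) (hs' : Primrec s') :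
    Primrec fun a => valueCheck (f a) (s a) (z a) (s' a) := by
  unfold valueCheck
  fun_prop

@[fun_prop]
theorem primrec_stepCheck {f : α → RecCode} {c : α → SubstCode} {q q' : α → FollowCode × ValueCode}
    (hf : Primrec f) (hq : Primrec q) (hc : Primrec c) (hq' : Primrec q') :
    Primrec fun a => stepCheck (f a) (q a) (c a) (q' a) := by
  unfold stepCheck
  fun_prop

@[fun_prop]
theorem primrec_allStates {f : α → RecCode} (hf : Primrec f) :
    Primrec fun a => allStates (f a) := by
  unfold allStates
  fun_prop

@[fun_prop]
theorem primrec_startCode {f : α → RecCode} (hf : Primrec f) :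
    Primrec fun a => startCode (f a) := by
  unfold startCode
  fun_prop

@[fun_prop]
theorem primrec_directingAutomaton {f : α → RecCode} {g : α → List SubstCode} (hf : Primrec f)
    (hg : Primrec g) : Primrec fun a => directingAutomaton (f a) (g a) := by
  unfold directingAutomaton
  fun_prop

@[fun_prop]
theorem primrec_allSubstCodes {f g : α → ℕ} (hf : Primrec f) (hg : Primrec g) :
    Primrec fun a => allSubstCodes (f a) (g a) := by
  unfold allSubstCodes
  fun_prop

theorem primrec_traceAutomaton : Primrec traceAutomaton := by
  unfold traceAutomaton segBound
  fun_prop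

theorem primrec_listAutomaton : Primrec listAutomaton := by
  have := primrec_recOfBuchi
  unfold listAutomaton
  fun_prop

end Primrec

end Algorithms

/-! ### Correctness of the algorithms -/

section Correctness

theorem getD_ofFn_equiv {X : Type*} {β : Type*} {n : ℕ} (e : X ≃ Fin n) (f : Fin n → β) (x : X)
    (d : β) : (List.ofFn f).getD (e x) d = f (e x) := by
  simp

theorem map_ofFn_equiv_injective {X Y : Type*} {β : Type*} {n : ℕ} (e : X ≃ Fin n) {g : Y → β}
    (hg : Function.Injective g) {f f' : X → Y}
    (h : List.ofFn (fun i => g (f (e.symm i))) = List.ofFn fun i => g (f' (e.symm i))) :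
    f = f' := by
  funext x
  have := congrFun (List.ofFn_injective h) (e x)
  simpa [hg.eq_iff] using this

/-- The code of an element of a semigroup with a neutral element adjoined. -/
def elemCode {F : Type*} {m : ℕ} (eF : F ≃ Fin m) (x : WithOne F) : ℕ :=
  WithOne.recOneCoe 0 (fun x => (eF x : ℕ) + 1) x

/-- The code of an optional element. -/
def optionCode {X : Type*} {n : ℕ} (e : X ≃ Fin n) (x : Option X) : ℕ :=
  x.elim 0 fun x => (e x : ℕ) + 1

theorem elemCode_one {F : Type*} {m : ℕ} (eF : F ≃ Fin m) : elemCode eF 1 = 0 := rfl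

theorem elemCode_coe {F : Type*} {m : ℕ} (eF : F ≃ Fin m) (x : F) :
    elemCode eF x = eF x + 1 := rfl

theorem optionCode_none {X : Type*} {n : ℕ} (e : X ≃ Fin n) : optionCode e none = 0 := rfl

theorem optionCode_some {X : Type*} {n : ℕ} (e : X ≃ Fin n) (x : X) :
    optionCode e (some x) = e x + 1 := rfl

theorem optionCode_injective {X : Type*} {n : ℕ} (e : X ≃ Fin n) :
    Function.Injective (optionCode e) := by
  intro x y h
  cases x <;> cases y <;> simp [optionCode, ← Fin.ext_iff] at h ⊢
  exact h

theorem elemCode_injective {F : Type*} {m : ℕ} (eF : F ≃ Fin m) :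
    Function.Injective (elemCode eF) := by
  intro x y h
  cases x <;> cases y <;> simp [elemCode_one, elemCode_coe, ← Fin.ext_iff] at h ⊢
  exact h

theorem exists_optionCode_iff {X : Type*} {n : ℕ} (e : X ≃ Fin n) (i : ℕ) :
    i ∈ List.range (n + 1) ↔ ∃ x, optionCode e x = i := by
  rw [List.mem_range]
  constructor
  · intro hi
    cases i with
    | zero => exact ⟨none, rfl⟩
    | succ i => exact ⟨some (e.symm ⟨i, by omega⟩), by simp [optionCode]⟩
  · rintro ⟨x, rfl⟩
    cases x with
    | none => simp [optionCode]
    | some x => simp [optionCode]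

theorem exists_elemCode_iff {F : Type*} {m : ℕ} (eF : F ≃ Fin m) (i : ℕ) :
    i ∈ List.range (m + 1) ↔ ∃ x, elemCode eF x = i := by
  rw [exists_optionCode_iff eF]
  constructor
  · rintro ⟨x, rfl⟩
    cases x with
    | none => exact ⟨1, rfl⟩
    | some x => exact ⟨x, rfl⟩
  · rintro ⟨x, rfl⟩
    cases x with
    | one => exact ⟨none, rfl⟩
    | coe x => exact ⟨some x, rfl⟩

variable {A : Type u} {M : OmegaSemigroup.{v, w}} {k m p : ℕ} (e : A ≃ Fin k) (eF : M.F ≃ Fin m)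
  (eI : M.I ≃ Fin p) (h₀ : A → M.F) (H : Set M.I)

/-- The code of the letter images of a morphism. -/
def morphismCode (h : A → M.F) : List ℕ := List.ofFn fun i => (eF (h (e.symm i)) : ℕ) + 1

/-- Letter images are stored with the offset `1`, as values in the semigroup with the neutral
element adjoined, whose code is `0`. -/
theorem morphismCode_getD (h : A → M.F) (a : A) (d : ℕ) :
    (morphismCode e eF h).getD (e a) d = elemCode eF (h a) := by
  rw [morphismCode, getD_ofFn_equiv, Equiv.symm_apply_apply, elemCode_coe]

theorem morphismCode_injective : Function.Injective (morphismCode (M := M) e eF) := fun _ _ h =>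
  map_ofFn_equiv_injective (g := fun x => (eF x : ℕ) + 1) e
    (fun x y hxy => by simpa [← Fin.ext_iff] using hxy) h

theorem mulElem_elemCode (x y : WithOne M.F) :
    mulElem (recCode e M eF eI h₀ H) (elemCode eF x) (elemCode eF y) = elemCode eF (x * y) := by
  cases x with
  | one => simp [mulElem, elemCode_one]
  | coe x =>
    cases y with
    | one => simp [mulElem, elemCode_one, elemCode_coe]
    | coe y =>
      rw [← WithOne.coe_mul, elemCode_coe, elemCode_coe, elemCode_coe]
      simp [mulElem, recCode]

theorem evalCode_wordCode (h : A → M.F) (x : List A) :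
    evalCode (recCode e M eF eI h₀ H) (morphismCode e eF h) (wordCode e x) =
      elemCode eF (evalWord M h x) := by
  have key : ∀ y : WithOne M.F, (wordCode e x).foldl (fun p a =>
      mulElem (recCode e M eF eI h₀ H) p ((morphismCode e eF h).getD a 0)) (elemCode eF y) =
        elemCode eF (y * evalWord M h x) := by
    induction x with
    | nil => intro y; simp [wordCode, evalWord_nil]
    | cons a x ih =>
      intro y
      have ih := ih (y * h a)
      simp only [wordCode, List.map_cons, List.foldl_cons] at ih ⊢
      rw [morphismCode_getD, mulElem_elemCode, ih, evalWord_cons, mul_assoc]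
  have := key 1
  rwa [one_mul, elemCode_one] at this

/-- Acceptance is asked only of values `x e^ω`, so the tables of the mixed product and of `x ↦ x^ω`
suffice. -/
theorem acceptCheck_eq_true_iff (x y : M.F) :
    acceptCheck (recCode e M eF eI h₀ H) (eF x) (eF y) = true ↔
      M.mix x (M.prod fun _ => y) ∈ H := by
  simp only [acceptCheck, recCode]
  rw [getD_ofFn_equiv eF, getD_ofFn_equiv eF, getD_ofFn_equiv eI, getD_ofFn_equiv eI]
  simp

theorem substCode_getD (σ : Substitution A) (a : A) (d : List ℕ) :
    (substCode e σ).getD (e a) d = wordCode e (σ.img a) := by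
  rw [substCode, getD_ofFn_equiv, Equiv.symm_apply_apply]

theorem headTailCheck_eq_true_iff (σ : Substitution A) (h : A → M.F) (a b : A) (z : WithOne M.F) :
    headTailCheck (recCode e M eF eI h₀ H) (substCode e σ) (morphismCode e eF h) (e a) (e b)
      (elemCode eF z) = true ↔ HeadTail σ h a b z := by
  obtain ⟨c, x, hx⟩ := List.exists_cons_of_ne_nil (σ.img_ne_nil a)
  have hw : wordCode e (c :: x) = (e c : ℕ) :: wordCode e x := rfl
  rw [headTailCheck, substCode_getD, HeadTail, hx, hw, List.head?_cons, List.tail_cons,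
    evalCode_wordCode, Bool.and_eq_true, decide_eq_true_eq, decide_eq_true_eq,
    (elemCode_injective eF).eq_iff, Option.some_inj, ← Fin.ext_iff, e.injective.eq_iff]
  constructor
  · rintro ⟨rfl, rfl⟩
    exact ⟨x, rfl, rfl⟩
  · rintro ⟨y, hy, rfl⟩
    simp only [List.cons.injEq] at hy
    exact ⟨hy.1, by rw [hy.2]⟩

/-- The code of a set of letters. -/
noncomputable def letterSetCode (D : Set A) : List ℕ :=
  setCode (List.range k) (fun a => (e a : ℕ)) D

theorem mem_range_iff_letter (c : ℕ) : c ∈ List.range k ↔ ∃ a, (e a : ℕ) = c := by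
  rw [List.mem_range]
  exact ⟨fun h => ⟨e.symm ⟨c, h⟩, by simp⟩, fun ⟨a, ha⟩ => ha ▸ (e a).2⟩

theorem mem_letterSetCode {D : Set A} {c : ℕ} :
    c ∈ letterSetCode e D ↔ ∃ a ∈ D, (e a : ℕ) = c :=
  mem_setCode fun s => (mem_range_iff_letter e _).2 ⟨s, rfl⟩

theorem letterCode_injective : Function.Injective fun a => (e a : ℕ) := fun _ _ h =>
  e.injective (Fin.ext h)

/-- The code of a state that follows a directed word. -/
noncomputable def followCode (d : FollowState A M) : FollowCode :=
  (morphismCode e eF d.1, letterSetCode e d.2.1, optionCode e d.2.2)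

/-- The code of a state that checks a value. -/
def valueCode (s : ValueState M) : ValueCode :=
  (elemCode eF s.1, optionCode eF s.2.1, s.2.2)

theorem followCode_injective : Function.Injective (followCode (M := M) e eF) := by
  rintro ⟨h, D, a⟩ ⟨h', D', a'⟩ heq
  simp only [followCode, Prod.mk.injEq] at heq
  obtain ⟨h₁, h₂, h₃⟩ := heq
  rw [morphismCode_injective e eF h₁, optionCode_injective e h₃,
    setCode_injective (fun s => (mem_range_iff_letter e _).2 ⟨s, rfl⟩) (letterCode_injective e) h₂]

theorem valueCode_injective : Function.Injective (valueCode (M := M) eF) := by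
  rintro ⟨x, y, f⟩ ⟨x', y', f'⟩ heq
  simp only [valueCode, Prod.mk.injEq] at heq
  obtain ⟨h₁, h₂, h₃⟩ := heq
  rw [elemCode_injective eF h₁, optionCode_injective eF h₂, h₃]

theorem map_evalCode_substCode (σ : Substitution A) (h : A → M.F) :
    (substCode e σ).map (fun x => evalCode (recCode e M eF eI h₀ H) (morphismCode e eF h) x) =
      morphismCode e eF (pullback h σ) := by
  rw [substCode, List.map_ofFn]
  refine congrArg List.ofFn (funext fun i => ?_)
  rw [Function.comp_apply, evalCode_wordCode, ← coe_pullback]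
  rfl

theorem followCheck_eq_true_iff (σ : Substitution A) (d d' : FollowState A M) (z : WithOne M.F) :
    followCheck (recCode e M eF eI h₀ H) (substCode e σ) (followCode e eF d) (elemCode eF z)
      (followCode e eF d') = true ↔ FollowStep σ d z d' := by
  obtain ⟨h, D, a⟩ := d
  obtain ⟨h', D', a'⟩ := d'
  simp only [followCheck, Bool.and_eq_true, Bool.or_eq_true, decide_eq_true_eq, List.all_eq_true,
    List.any_eq_true, Bool.not_eq_true', decide_eq_false_iff_not]
  simp only [followCode, FollowStep, map_evalCode_substCode, (morphismCode_injective e eF).eq_iff,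
    or_assoc]
  rw [and_assoc]
  refine and_congr Iff.rfl (and_congr ?_ ?_)
  · rw [← elemCode_one eF]
    constructor
    · intro hD b hb
      obtain ⟨_, hc, hcb⟩ := hD _ ((mem_letterSetCode e).2 ⟨b, hb, rfl⟩)
      obtain ⟨c, hcD, rfl⟩ := (mem_letterSetCode e).1 hc
      exact ⟨c, hcD, (headTailCheck_eq_true_iff e eF eI h₀ H σ h c b 1).1 hcb⟩
    · intro hD _ hb
      obtain ⟨b, hbD, rfl⟩ := (mem_letterSetCode e).1 hb
      obtain ⟨c, hc, hcb⟩ := hD b hbD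
      exact ⟨_, (mem_letterSetCode e).2 ⟨c, hc, rfl⟩,
        (headTailCheck_eq_true_iff e eF eI h₀ H σ h c b 1).2 hcb⟩
  · have hz : elemCode eF z = 0 ↔ z = 1 := by
      rw [← elemCode_one eF, (elemCode_injective eF).eq_iff]
    have hy : (∃ y ∈ letterSetCode e D', elemCode eF z = (morphismCode e eF h').getD y 0) ↔
        ∃ c ∈ D', z = h' c := by
      constructor
      · rintro ⟨_, hy, hzy⟩
        obtain ⟨c, hc, rfl⟩ := (mem_letterSetCode e).1 hy
        rw [morphismCode_getD, (elemCode_injective eF).eq_iff] at hzy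
        exact ⟨c, hc, hzy⟩
      · rintro ⟨c, hc, rfl⟩
        exact ⟨_, (mem_letterSetCode e).2 ⟨c, hc, rfl⟩, (morphismCode_getD e eF h' c 0).symm⟩
    rw [hz, hy]
    cases a with
    | none =>
      cases a' with
      | none => simp [optionCode]
      | some c =>
        simp only [optionCode_some, optionCode_none, Nat.add_sub_cancel, morphismCode_getD,
          (elemCode_injective eF).eq_iff]
        simp
    | some b =>
      cases a' with
      | none => simp [optionCode]
      | some c =>
        simp only [optionCode_some, Nat.add_sub_cancel, headTailCheck_eq_true_iff]
        simp

theorem valueCheck_eq_true_iff (s s' : ValueState M) (z : WithOne M.F) :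
    valueCheck (recCode e M eF eI h₀ H) (valueCode eF s) (elemCode eF z) (valueCode eF s') = true ↔
      ValueStep H s z s' := by
  obtain ⟨x, y, f⟩ := s
  simp only [valueCheck, ValueStep, Bool.and_eq_true, Bool.or_eq_true, decide_eq_true_eq,
    Bool.not_eq_true', decide_eq_false_iff_not, or_assoc]
  have hmul : mulElem (recCode e M eF eI h₀ H) (valueCode eF (x, y, f)).1 (elemCode eF z) =
      elemCode eF (x * z) := mulElem_elemCode e eF eI h₀ H x z
  rw [hmul]
  refine or_congr ?_ (or_congr ?_ ?_)
  · rw [← (valueCode_injective eF).eq_iff]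
    rfl
  · have hnone : (valueCode eF (x, y, f)).2.1 = 0 ↔ y = none :=
      (optionCode_injective eF).eq_iff' rfl
    rw [hnone]
    simp only [and_assoc]
    refine and_congr Iff.rfl ?_
    generalize x * z = t
    constructor
    -- The guessed period is read off the target state; non-zero codes mean that the stem value and
    -- the period lie in `M.F`.
    · rintro ⟨h₁, h₂, h₃, h₄⟩
      cases t with
      | one => exact absurd rfl h₁
      | coe t =>
        obtain ⟨x', y', f'⟩ := s'
        cases y' with
        | none => exact absurd rfl h₂
        | some c =>
          refine ⟨t, c, rfl, (acceptCheck_eq_true_iff e eF eI h₀ H t c).1 h₃, ?_⟩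
          exact valueCode_injective eF h₄
    · rintro ⟨t, c, rfl, hH, rfl⟩
      exact ⟨Nat.succ_ne_zero _, Nat.succ_ne_zero _,
        (acceptCheck_eq_true_iff e eF eI h₀ H t c).2 hH, rfl⟩
  · cases y with
    | none => simp [valueCode, optionCode]
    | some c =>
      have hc : (valueCode eF (x, some c, f)).2.1 = elemCode eF (c : WithOne M.F) := rfl
      rw [hc, (elemCode_injective eF).eq_iff]
      constructor
      · rintro ⟨⟨-, h₁⟩, h₂⟩
        exact ⟨c, rfl, h₁, valueCode_injective eF h₂⟩
      · rintro ⟨c', hc', h₁, rfl⟩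
        obtain rfl : c = c' := Option.some.inj hc'
        exact ⟨⟨Nat.succ_ne_zero _, h₁⟩, rfl⟩

/-- The code of a state. -/
noncomputable def stateCode (q : FollowState A M × ValueState M) : FollowCode × ValueCode :=
  (followCode e eF q.1, valueCode eF q.2)

theorem stateCode_injective : Function.Injective (stateCode (M := M) e eF) := by
  rintro ⟨d, s⟩ ⟨d', s'⟩ heq
  simp only [stateCode, Prod.mk.injEq] at heq
  rw [followCode_injective e eF heq.1, valueCode_injective eF heq.2]

/-- The common value `z` of the two steps is found by search through the `m + 1` codes of values. -/
theorem stepCheck_eq_true_iff (σ : Substitution A) (q q' : FollowState A M × ValueState M) :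
    stepCheck (recCode e M eF eI h₀ H) (stateCode e eF q) (substCode e σ) (stateCode e eF q') =
      true ↔ ∃ z, FollowStep σ q.1 z q'.1 ∧ ValueStep H q.2 z q'.2 := by
  have hm : (recCode e M eF eI h₀ H).2.1 = m := rfl
  rw [stepCheck, List.any_eq_true, hm]
  simp only [Bool.and_eq_true, exists_elemCode_iff eF, stateCode]
  constructor
  · rintro ⟨_, ⟨z, rfl⟩, h₁, h₂⟩
    exact ⟨z, (followCheck_eq_true_iff e eF eI h₀ H σ _ _ z).1 h₁,
      (valueCheck_eq_true_iff e eF eI h₀ H _ _ z).1 h₂⟩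
  · rintro ⟨z, h₁, h₂⟩
    exact ⟨_, ⟨z, rfl⟩, (followCheck_eq_true_iff e eF eI h₀ H σ _ _ z).2 h₁,
      (valueCheck_eq_true_iff e eF eI h₀ H _ _ z).2 h₂⟩

/-! ### States and runs of the computed automaton -/

theorem mem_morphismCodes (l : List ℕ) :
    l ∈ listsOfLength ((List.range m).map (· + 1)) k ↔ ∃ h : A → M.F, morphismCode e eF h = l := by
  rw [mem_listsOfLength]
  constructor
  · rintro ⟨rfl, hl⟩
    have : ∀ a, ∃ x : M.F, (eF x : ℕ) + 1 = l[(e a : ℕ)]'(e a).2 := by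
      intro a
      obtain ⟨i, hi, hia⟩ := List.mem_map.1 (hl _ (List.getElem_mem (e a).2))
      exact ⟨eF.symm ⟨i, List.mem_range.1 hi⟩, by simpa using hia⟩
    choose h hh using this
    refine ⟨h, ?_⟩
    apply List.ext_getElem
    · simp [morphismCode]
    · intro i h₁ h₂
      simp [morphismCode, hh]
  · rintro ⟨h, rfl⟩
    refine ⟨by simp [morphismCode], fun x hx => ?_⟩
    rw [morphismCode, List.mem_ofFn] at hx
    obtain ⟨i, rfl⟩ := hx
    exact List.mem_map.2 ⟨_, List.mem_range.2 (eF _).2, rfl⟩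

theorem mem_allStates (q : FollowCode × ValueCode) :
    q ∈ allStates (recCode e M eF eI h₀ H) ↔ ∃ x, stateCode (M := M) e eF x = q := by
  obtain ⟨⟨l, D, a⟩, y, c, f⟩ := q
  have hk : (recCode e M eF eI h₀ H).1 = k := rfl
  have hm : (recCode e M eF eI h₀ H).2.1 = m := rfl
  simp only [allStates, List.pair_mem_product, hk, hm, mem_morphismCodes e eF,
    exists_elemCode_iff eF y, exists_optionCode_iff eF c, exists_optionCode_iff e a,
    mem_sublists'_iff_setCode List.nodup_range (mem_range_iff_letter e)]
  constructor
  · rintro ⟨⟨⟨h, rfl⟩, ⟨D, rfl⟩, ⟨a, rfl⟩⟩, ⟨y, rfl⟩, ⟨c, rfl⟩, -⟩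
    exact ⟨((h, D, a), (y, c, f)), rfl⟩
  · rintro ⟨⟨⟨h, D, a⟩, y, c, f⟩, hq⟩
    simp only [stateCode, followCode, valueCode, Prod.mk.injEq] at hq
    obtain ⟨⟨rfl, rfl, rfl⟩, rfl, rfl, rfl⟩ := hq
    exact ⟨⟨⟨h, rfl⟩, ⟨D, rfl⟩, ⟨a, rfl⟩⟩, ⟨y, rfl⟩, ⟨c, rfl⟩, by cases f <;> simp⟩

theorem startCode_recCode :
    startCode (recCode e M eF eI h₀ H) = stateCode e eF ((h₀, ∅, none), (1, none, false)) := by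
  have hD : letterSetCode e (∅ : Set A) = [] := by
    rw [List.eq_nil_iff_forall_not_mem]
    intro c hc
    obtain ⟨a, ha, -⟩ := (mem_letterSetCode e).1 hc
    exact ha
  simp only [startCode, stateCode, followCode, valueCode, recCode, hD, List.map_ofFn, morphismCode]
  rfl

/-- States are numbered by their encodings, so the number of states only has to exceed all of these.
Numbers that encode no listed state have no transitions. -/
theorem encode_lt_foldr {B : Type*} [Encodable B] {l : List B} {q : B} (hq : q ∈ l) :
    Encodable.encode q < l.foldr (fun q n => Encodable.encode q + n) 1 := by
  have hpos : ∀ l : List B, 0 < l.foldr (fun q n => Encodable.encode q + n) 1 := by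
    intro l
    induction l with
    | nil => simp
    | cons c l ih => rw [List.foldr_cons]; omega
  induction l with
  | nil => simp at hq
  | cons c l ih =>
    rw [List.foldr_cons]
    rcases List.mem_cons.1 hq with rfl | hq
    · have := hpos l
      omega
    · have := ih hq
      omega

/-- Each state of an infinite run is the source of a transition and hence the encoding of an actual
state. -/
theorem directingAutomaton_accepts_iff {Ξ : Type*} (rep : SubstCode → Ξ → Prop) (ξ : ℕ → Ξ)
    (W : List SubstCode) :
    ((directingAutomaton (recCode e M eF eI h₀ H) W).toBuchi rep).Accepts ξ ↔
      ∃ x : ℕ → FollowState A M × ValueState M, x 0 = ((h₀, ∅, none), (1, none, false)) ∧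
        (∀ n, ∃ c ∈ W, rep c (ξ n) ∧ stepCheck (recCode e M eF eI h₀ H) (stateCode e eF (x n)) c
          (stateCode e eF (x (n + 1))) = true) ∧ ∀ N, ∃ n, N ≤ n ∧ (x n).2.2.2 = true := by
  constructor
  · rintro ⟨r, hr0, hr, hacc⟩
    have hstate : ∀ n, ∃ x, Encodable.encode (stateCode (M := M) e eF x) = r n := by
      intro n
      obtain ⟨c, hc, -⟩ := hr n
      obtain ⟨t, ht, htr⟩ := List.mem_map.1 hc
      have ht := (List.mem_product.1 (List.mem_filter.1 ht).1).1
      obtain ⟨x, hx⟩ := (mem_allStates e eF eI h₀ H _).1 ht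
      exact ⟨x, by rw [hx]; exact congrArg Prod.fst htr⟩
    choose x hx using hstate
    refine ⟨x, ?_, fun n => ?_, fun N => ?_⟩
    · apply stateCode_injective e eF
      apply Encodable.encode_injective
      rw [hx, ← startCode_recCode e eF eI]
      exact List.mem_singleton.1 hr0
    · obtain ⟨c, hc, hrep⟩ := hr n
      obtain ⟨⟨q, c', q'⟩, ht, htr⟩ := List.mem_map.1 hc
      obtain ⟨hmem, hstep⟩ := List.mem_filter.1 ht
      have hW := (List.mem_product.1 (List.mem_product.1 hmem).2).1
      simp only [Prod.mk.injEq, ← hx] at htr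
      obtain ⟨h₁, rfl, h₂⟩ := htr
      rw [Encodable.encode_injective h₁, Encodable.encode_injective h₂] at hstep
      exact ⟨c', hW, hrep, hstep⟩
    · obtain ⟨n, hn, hacc⟩ := hacc N
      obtain ⟨q, hq, hqn⟩ := List.mem_map.1 hacc
      have hq := (List.mem_filter.1 hq).2
      rw [← hx] at hqn
      rw [Encodable.encode_injective hqn] at hq
      exact ⟨n, hn, hq⟩
  · rintro ⟨x, hx0, hx, hacc⟩
    have hmem : ∀ n, stateCode e eF (x n) ∈ allStates (recCode e M eF eI h₀ H) := fun n =>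
      (mem_allStates e eF eI h₀ H _).2 ⟨_, rfl⟩
    refine ⟨fun n => ⟨Encodable.encode (stateCode e eF (x n)), encode_lt_foldr (hmem n)⟩, ?_,
      fun n => ?_, fun N => ?_⟩
    · refine List.mem_singleton.2 ?_
      rw [startCode_recCode, ← hx0]
    · obtain ⟨c, hW, hrep, hstep⟩ := hx n
      refine ⟨c, List.mem_map.2 ⟨(stateCode e eF (x n), c, stateCode e eF (x (n + 1))), ?_, rfl⟩,
        hrep⟩
      exact List.mem_filter.2 ⟨List.mem_product.2 ⟨hmem n, List.mem_product.2 ⟨hW, hmem (n + 1)⟩⟩,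
        hstep⟩
    · obtain ⟨n, hn, hacc⟩ := hacc N
      exact ⟨n, hn, List.mem_map.2 ⟨_, List.mem_filter.2 ⟨hmem n, hacc⟩, rfl⟩⟩

/-- The automaton over the codes in `W` is correct if the codes that represent the letters of `ξ`
are codes of substitutions equivalent to those in `s`, and if `W` represents each letter of `ξ`. -/
theorem directingAutomaton_accepts_iff_directs {Ξ : Type*} (rep : SubstCode → Ξ → Prop)
    (ξ : ℕ → Ξ) (W : List SubstCode) (s : ℕ → Substitution A)
    (hrep : ∀ n c, rep c (ξ n) → ∃ σ, c = substCode e σ ∧ Xi.mk M σ = Xi.mk M (s n))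
    (hW : ∀ n, ∃ c ∈ W, rep c (ξ n)) :
    ((directingAutomaton (recCode e M eF eI h₀ H) W).toBuchi rep).Accepts ξ ↔
      ∃ α, M.prod (fun n => h₀ (α n)) ∈ H ∧ Directs s α := by
  have : Finite M.F := Finite.of_equiv _ eF.symm
  rw [directingAutomaton_accepts_iff, exists_directs_iff]
  constructor
  · rintro ⟨x, hx0, hx, hacc⟩
    refine ⟨fun n => (x n).1, fun n => (x n).2, by simp [hx0], by simp [hx0], fun n => ?_, hacc⟩
    obtain ⟨c, -, hc, hstep⟩ := hx n
    obtain ⟨σ, rfl, hσ⟩ := hrep n c hc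
    obtain ⟨z, h₁, h₂⟩ := (stepCheck_eq_true_iff e eF eI h₀ H σ _ _).1 hstep
    exact ⟨z, h₁.congr hσ, h₂⟩
  · rintro ⟨d, c, hd0, hc0, hdc, hacc⟩
    refine ⟨fun n => (d n, c n), by simp [hd0, hc0], fun n => ?_, hacc⟩
    obtain ⟨c, hcW, hc⟩ := hW n
    obtain ⟨σ, rfl, hσ⟩ := hrep n c hc
    obtain ⟨z, h₁, h₂⟩ := hdc n
    exact ⟨_, hcW, hc,
      (stepCheck_eq_true_iff e eF eI h₀ H σ _ _).2 ⟨z, h₁.congr hσ.symm, h₂⟩⟩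

/-- The list also contains codes with empty images. These are harmless: they are codes of no
substitution and represent no letter. -/
theorem substCode_mem_allSubstCodes {N : ℕ} {σ : Substitution A}
    (hσ : ∀ a, (σ.img a).length ≤ N) : substCode e σ ∈ allSubstCodes k N := by
  rw [allSubstCodes, mem_listsOfLength]
  refine ⟨by simp [substCode], fun x hx => ?_⟩
  rw [substCode, List.mem_ofFn] at hx
  obtain ⟨i, rfl⟩ := hx
  rw [List.mem_flatMap]
  refine ⟨(σ.img (e.symm i)).length, List.mem_range.2 (Nat.lt_succ_of_le (hσ _)), ?_⟩
  rw [mem_listsOfLength]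
  refine ⟨by simp [wordCode], fun c hc => ?_⟩
  obtain ⟨a, -, rfl⟩ := List.mem_map.1 hc
  exact List.mem_range.2 (e a).2

/-- Every class has a representative within the length bound, so every letter of `Ξ` is represented
in the list. -/
theorem traceAutomaton_accepts_iff (s : ℕ → Substitution A) :
    (automatonOverXi e M (traceAutomaton (recCode e M eF eI h₀ H))).Accepts (trace M s) ↔
      ∃ α, M.prod (fun n => h₀ (α n)) ∈ H ∧ Directs s α := by
  have : Finite M.F := Finite.of_equiv _ eF.symm
  have : Finite A := Finite.of_equiv _ e.symm
  refine directingAutomaton_accepts_iff_directs e eF eI h₀ H _ _ _ s (fun n c hc => hc)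
    fun n => ?_
  obtain ⟨μ, hμ, hlen⟩ := exists_mk_eq_length_le (M := M) h₀ (s n)
  rw [Nat.card_congr e, Nat.card_congr eF, Nat.card_fin, Nat.card_fin] at hlen
  exact ⟨substCode e μ, substCode_mem_allSubstCodes e hlen, μ, rfl, hμ.symm⟩

end Correctness

/-- The codes of the elements of `S` serve as the letters directly, so no bounded representatives
are needed. -/
theorem listAutomaton_accepts_iff {A : Type u} {k : ℕ} (e : A ≃ Fin k) (b : BuchiCode ℕ)
    (S : List (Substitution A)) (s : ℕ → {σ // σ ∈ S}) :
    (automatonOverList e S (listAutomaton (k, b, S.map (substCode e)))).Accepts s ↔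
      ∃ α : ℕ → A, (automatonOver e b).Accepts α ∧ Directs (fun n => (s n).1) α := by
  obtain ⟨M, m, p, eF, eI, h, H, hR, hrec⟩ := recOfBuchi_spec e b
  have hG : listAutomaton (k, b, S.map (substCode e)) =
      directingAutomaton (recCode e M eF eI h H) (S.map (substCode e)) := by
    rw [listAutomaton, hR]
  rw [hG, automatonOverList, directingAutomaton_accepts_iff_directs e eF eI h H _ _ _
    (fun n => (s n).1)]
  · exact exists_congr fun α => and_congr_left fun _ => (hrec α).symm
  · rintro n c rfl
    exact ⟨_, rfl, rfl⟩
  · exact fun n => ⟨_, List.mem_map.2 ⟨_, (s n).2, rfl⟩, rfl⟩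

/-- There are algorithms `R`, `T`, `G` as follows.
`R`: from a Büchi automaton for `L`, a finite ω-semigroup `M` and a morphism that recognise `L`.
`T`: from any morphism into a finite ω-semigroup `M` recognising `L`, a Büchi automaton over the
finite monoid `Ξ` that accepts the trace of `s` if and only if `s` directs a word in `L`.
`G`: from a Büchi automaton for `L` and a finite set `S` of substitutions, a Büchi automaton over
`S` that accepts `s` if and only if `s` directs a word in `L`. -/
theorem mainTheorem1 :
    ∃ (R : ℕ × BuchiCode ℕ → RecCode)
      (T : RecCode → BuchiCode SubstCode)
      (G : ℕ × BuchiCode ℕ × List SubstCode → BuchiCode SubstCode),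
      Computable R ∧ Computable T ∧ Computable G ∧
      (∀ (A : Type u) [Nonempty A] (k : ℕ) (e : A ≃ Fin k) (b : BuchiCode ℕ),
        ∃ (M : OmegaSemigroup.{0, 0}) (m p : ℕ) (eF : M.F ≃ Fin m) (eI : M.I ≃ Fin p)
          (h : A → M.F) (H : Set M.I),
          R (k, b) = recCode e M eF eI h H ∧
          Recognises M h H {α | (automatonOver e b).Accepts α}) ∧
      (∀ (A : Type u) [Nonempty A] (k : ℕ) (e : A ≃ Fin k)
        (M : OmegaSemigroup.{v, w}) (m p : ℕ) (eF : M.F ≃ Fin m) (eI : M.I ≃ Fin p)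
        (h : A → M.F) (H : Set M.I) (L : Set (ℕ → A)),
        Recognises M h H L →
          (Finite (Xi A M) ∧
            ∃ _ : Monoid (Xi A M), Xi.mk M (Substitution.id A) = 1 ∧
              ∀ σ μ : Substitution A, Xi.mk M (σ.comp μ) = Xi.mk M σ * Xi.mk M μ) ∧
          ∀ s : ℕ → Substitution A,
            (automatonOverXi e M (T (recCode e M eF eI h H))).Accepts (trace M s) ↔
              ∃ α ∈ L, Directs s α) ∧
      (∀ (A : Type u) [Nonempty A] (k : ℕ) (e : A ≃ Fin k) (b : BuchiCode ℕ)
        (S : List (Substitution A)) (s : ℕ → {σ // σ ∈ S}),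
        (automatonOverList e S (G (k, b, S.map (substCode e)))).Accepts s ↔
          ∃ α : ℕ → A, (automatonOver e b).Accepts α ∧ Directs (fun n => (s n).1) α) := by
  refine ⟨recOfBuchi, traceAutomaton, listAutomaton, primrec_recOfBuchi.to_comp,
    primrec_traceAutomaton.to_comp, primrec_listAutomaton.to_comp, ?_, ?_, ?_⟩
  · intro A _ k e b
    exact recOfBuchi_spec e b
  · intro A _ k e M m p eF eI h H L hL
    have : Finite M.F := Finite.of_equiv _ eF.symm
    have : Finite A := Finite.of_equiv _ e.symm
    refine ⟨⟨finite_Xi, exists_monoid_Xi A M⟩, fun s => ?_⟩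
    rw [traceAutomaton_accepts_iff]
    exact exists_congr fun α => and_congr_left fun _ => (hL α).symm
  · intro A _ k e b S s
    exact listAutomaton_accepts_iff e b S s
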